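/- **IO Dual Subspace Anti-Concentration.** Conventions: Boolean circuits and quantum circuits are nonuniform; the complexity of a quantum algorithm is its number of elementary gates (one-qubit unitaries, CNOT, Toffoli), its ancillas start in $|0\rangle$ and its output is measured in the computational basis. For a subspace $V\subseteq\mathbb{Z}_2^k$, $V^\perp$ is its dual with respect to the standard dot product. Let $\mathsf{iO}$ be an indistinguishability obfuscator for Boolean circuits: it is computable by polynomial-size circuits (in particular it may be any probabilistic polynomial-time algorithm), it is perfectly correct, and it is $(f_{\mathsf{iO}},\epsilon_{\mathsf{iO}})$-secure, i.e. for all $\kappa,p$ and all functionally equivalent circuits $C_0,C_1$ of size at most $p$, no quantum algorithm of complexity at most $f_{\mathsf{iO}}(\kappa)$ distinguishes $\mathsf{iO}(1^{\kappa},1^{p},C_0)$ from $\mathsf{iO}(1^{\kappa},1^{p},C_1)$ with advantage greater than $\epsilon_{\mathsf{iO}}(\kappa)$. Assume that there exists an $(f_{\mathsf{OWF}},\epsilon_{\mathsf{OWF}})$-secure injective one-way function, i.e. a family of injective functions $F_n$ on $\{0,1\}^n$, computable by polynomial-size circuits, such that no quantum algorithm of complexity at most $f_{\mathsf{OWF}}(n)$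 inverts $F_n(x)$ for uniformly random $x$ with probability greater than $\epsilon_{\mathsf{OWF}}(n)$. For every $k$ and every subspace $T\subseteq\mathbb{Z}_2^k$ fix a Boolean circuit $C_T$, of size polynomial in $k$, that checks membership in $T$. Let $K$ and $\kappa$ be polynomials. Then for every sufficiently large polynomial $p$ there is a polynomial $q$ such that the following holds. Let $\lambda,k,r,s\in\mathbb{N}$ with $r+s\le k\le K(\lambda)$, put $t:=k-r-s$ and assume $\lambda\le t$. Let $S\subseteq\mathbb{Z}_2^k$ be a subspace of dimension $r$, and let $\mathcal{O}$ be the distribution that samples a uniformly random subspace $T$ of dimension $r+s$ with $S\subseteq T\subseteq\mathbb{Z}_2^k$ and then $\mathsf{O}_T\leftarrow\mathsf{iO}(1^{\kappa(\lambda)},1^{p(\lambda)},C_T)$. Put $f:=\min(f_{\mathsf{OWF}}(\lambda),f_{\mathsf{iO}}(\kappa(\lambda)))$ and assume $f>0$ and $\max(\epsilon_{\mathsf{OWF}}(\lambda),\epsilon_{\mathsf{iO}}(\kappa(\lambda)))\le 1/f$. Let $\epsilon>0$ and let $\mathcal{A}$ be a quantum algorithm of complexity at most $T_{\mathcal{A}}$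 such that $$\Pr\left[\mathcal{A}(\mathsf{O}_T)\in T^\perp\setminus\{0\}\;:\;\mathsf{O}_T\leftarrow\mathcal{O}\right]\ge\epsilon .$$ Put $\ell:=k(t+1)/\epsilon$ and assume $$(1)\quad \frac{t}{2^{s-t}}\le\frac{\epsilon}{2},\qquad\qquad (2)\quad \frac{\ell\cdot\left(k^3+q(\lambda)+T_{\mathcal{A}}\right)}{f}\le\frac18 .$$ Then $$\Pr\left[\mathcal{A}(\mathsf{O}_T)\in S^\perp\setminus T^\perp\;:\;\mathsf{O}_T\leftarrow\mathcal{O}\right]\ge\frac{\epsilon}{16\,k\,(t+1)} .$$ -/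

import Mathlib

open scoped BigOperators

namespace DualSubspace

/-! ### Boolean circuits -/

/-- A Boolean circuit with `n` input bits and `m` output bits. The wires are numbered: wires
`0, …, n-1` carry the input, and the `i`-th gate `(a, b)` creates wire `n + i`, carrying the NAND of
wires `a` and `b`. A reference to a wire that does not exist (yet) is the constant `false`. -/
structure BoolCircuit (n m : ℕ) where
  gates : List (ℕ × ℕ)
  outputs : Fin m → ℕ

namespace BoolCircuit

variable {n m : ℕ}

/-- The values of all wires on input `x`. -/
def wireValues (C : BoolCircuit n m) (x : Fin n → Bool) : List Bool :=
  C.gates.foldl (fun w g => w ++ [!(w.getD g.1 false && w.getD g.2 false)]) (List.ofFn x)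

def eval (C : BoolCircuit n m) (x : Fin n → Bool) : Fin m → Bool :=
  fun j => (C.wireValues x).getD (C.outputs j) false

/-- The size counts inputs, gates and outputs. -/
def size (C : BoolCircuit n m) : ℕ := n + C.gates.length + m

/-- The unit vector of length `N` with a one at position `i` (all zeros if `N ≤ i`). -/
def oneHot (N i : ℕ) : List Bool := (List.range N).map (fun j => decide (j = i))

/-- One slot of the description of a circuit: a bit saying whether the gate is present, followed by
its two wires. -/
def gateBits (N : ℕ) : Option (ℕ × ℕ) → List Bool
  | some g => true :: (oneHot N g.1 ++ oneHot N g.2)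
  | none => List.replicate (2 * N + 1) false

/-- The description, as a bit string, of a circuit of size at most `N`: the gates, padded to `N`
slots, followed by the output wires. -/
def desc (N : ℕ) (C : BoolCircuit n m) : List Bool :=
  (List.range N).flatMap (fun i => gateBits N C.gates[i]?) ++
    (List.finRange m).flatMap (fun j => oneHot N (C.outputs j))

end BoolCircuit

/-- The length of the description of a circuit of size at most `N` with `m` outputs. -/
def descLen (N m : ℕ) : ℕ := N * (2 * N + 1) + m * N

theorem BoolCircuit.length_desc {n m : ℕ} (N : ℕ) (C : BoolCircuit n m) :
    (C.desc N).length = descLen N m := by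
  have h : ∀ o, (gateBits N o).length = 2 * N + 1 := by
    intro o
    cases o <;> simp [gateBits, oneHot]
    ring
  simp [desc, descLen, List.length_flatMap, h, oneHot]

/-- The first `L` bits of a bit string, padded with zeros. -/
def bits (L : ℕ) (l : List Bool) : Fin L → Bool := fun i => l.getD i false

/-! ### Quantum circuits -/

/-- An elementary gate on `w` qubits: an arbitrary one-qubit unitary, a CNOT, or a Toffoli gate. -/
inductive QGate (w : ℕ) where
  | single (U : Matrix.unitaryGroup Bool ℂ) (i : Fin w)
  | cnot (c t : Fin w) (h : c ≠ t)
  | toffoli (a b t : Fin w) (hab : a ≠ b) (ha : a ≠ t) (hb : b ≠ t)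

/-- The action of a gate on a vector of amplitudes indexed by the computational basis. -/
noncomputable def QGate.apply {w : ℕ} : QGate w → ((Fin w → Bool) → ℂ) → ((Fin w → Bool) → ℂ)
  | .single U i, ψ => fun x => ∑ b : Bool, (U : Matrix Bool Bool ℂ) (x i) b * ψ (Function.update x i b)
  | .cnot c t _, ψ => fun x => ψ (Function.update x t (xor (x t) (x c)))
  | .toffoli a b t _ _ _, ψ => fun x => ψ (Function.update x t (xor (x t) (x a && x b)))

/-- A quantum algorithm, as a (nonuniform) quantum circuit: `wires` qubits, a sequence of elementary
gates, and `m` qubits that are read out by a final measurement in the computational basis. -/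
structure QCircuit (m : ℕ) where
  wires : ℕ
  gates : List (QGate wires)
  out : Fin m → Fin wires

namespace QCircuit

variable {m : ℕ}

/-- The complexity is the number of elementary gates. -/
def size (A : QCircuit m) : ℕ := A.gates.length

/-- The initial state on the classical input `x`: the basis state `x`, followed by `|0⟩` ancillas. -/
def initState (A : QCircuit m) (x : List Bool) : (Fin A.wires → Bool) → ℂ :=
  fun v => if v = bits A.wires x then 1 else 0

noncomputable def finalState (A : QCircuit m) (x : List Bool) : (Fin A.wires → Bool) → ℂ :=
  A.gates.foldl (fun ψ g => g.apply ψ) (A.initState x)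

open Classical in
/-- The probability that the output of `A` on the classical input `x` satisfies `E`. -/
noncomputable def prob (A : QCircuit m) (x : List Bool) (E : (Fin m → Bool) → Prop) : ℝ :=
  ∑ v : Fin A.wires → Bool, if E (fun j => v (A.out j)) then ‖A.finalState x v‖ ^ 2 else 0

end QCircuit

/-! ### Indistinguishability obfuscation -/

/-- A randomized transformation of Boolean circuits. `obf κ p C ρ` is the circuit output on security
parameter `κ`, size parameter `p`, circuit `C` and random coins `ρ`. -/
structure Obfuscator where
  coins : ℕ → ℕ → ℕ
  outSize : ℕ → ℕ → ℕ
  obf : (κ p : ℕ) → {n m : ℕ} → BoolCircuit n m → (Fin (coins κ p) → Bool) → BoolCircuit n m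

namespace Obfuscator

/-- Efficiency: on inputs of size at most `p`, the obfuscated circuit has size at most `outSize κ p`
and its description is computed from the description of the input and the random coins by a Boolean
circuit of size polynomial in `κ` and `p`. Every probabilistic polynomial-time algorithm is
efficient in this (nonuniform) sense. -/
def Efficient (iO : Obfuscator) : Prop :=
  ∃ Q : Polynomial ℕ, ∀ κ p n m : ℕ, n + m ≤ p →
    ∃ D : BoolCircuit (descLen p m + iO.coins κ p) (descLen (iO.outSize κ p) m),
      D.size ≤ Q.eval (κ + p) ∧
      ∀ (C : BoolCircuit n m) (ρ : Fin (iO.coins κ p) → Bool), C.size ≤ p →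
        (iO.obf κ p C ρ).size ≤ iO.outSize κ p ∧
        D.eval (bits _ (C.desc p ++ List.ofFn ρ)) =
          bits _ ((iO.obf κ p C ρ).desc (iO.outSize κ p))

/-- Perfect correctness. -/
def Correct (iO : Obfuscator) : Prop :=
  ∀ (κ p n m : ℕ) (C : BoolCircuit n m) (ρ : Fin (iO.coins κ p) → Bool), C.size ≤ p →
    (iO.obf κ p C ρ).eval = C.eval

/-- The probability that the output of `A`, given a random obfuscation of `C`, satisfies `E`. -/
noncomputable def probOn (iO : Obfuscator) (κ p : ℕ) {n m l : ℕ} (C : BoolCircuit n m)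
    (A : QCircuit l) (E : (Fin l → Bool) → Prop) : ℝ :=
  𝔼 ρ : Fin (iO.coins κ p) → Bool, A.prob ((iO.obf κ p C ρ).desc (iO.outSize κ p)) E

/-- `(f, ε)`-security: no quantum circuit of size at most `f κ` distinguishes the obfuscations of two
functionally equivalent circuits with advantage greater than `ε κ`. -/
def Secure (iO : Obfuscator) (f : ℕ → ℕ) (ε : ℕ → ℝ) : Prop :=
  ∀ (κ p n m : ℕ) (C₀ C₁ : BoolCircuit n m), C₀.eval = C₁.eval → C₀.size ≤ p → C₁.size ≤ p →
    ∀ A : QCircuit 1, A.size ≤ f κ →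
      |iO.probOn κ p C₀ A (fun b => b 0 = true) - iO.probOn κ p C₁ A (fun b => b 0 = true)| ≤ ε κ

end Obfuscator

/-- An indistinguishability obfuscator that is `(f, ε)`-secure. -/
structure IsIO (iO : Obfuscator) (f : ℕ → ℕ) (ε : ℕ → ℝ) : Prop where
  efficient : iO.Efficient
  correct : iO.Correct
  secure : iO.Secure f ε

/-! ### One-way functions -/

/-- `F` is an `(f, ε)`-secure injective one-way function: each `F n` is injective, `F` is computed by
Boolean circuits of polynomial size, and no quantum circuit of size at most `f n` inverts `F n` on a
uniformly random input with probability greater than `ε n`. -/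
structure IsInjectiveOWF {outLen : ℕ → ℕ} (F : (n : ℕ) → (Fin n → Bool) → (Fin (outLen n) → Bool))
    (f : ℕ → ℕ) (ε : ℕ → ℝ) : Prop where
  injective : ∀ n, Function.Injective (F n)
  efficient : ∃ Q : Polynomial ℕ, ∀ n, ∃ D : BoolCircuit n (outLen n),
    D.size ≤ Q.eval n ∧ D.eval = F n
  secure : ∀ n, ∀ A : QCircuit n, A.size ≤ f n →
    𝔼 x : Fin n → Bool, A.prob (List.ofFn (F n x)) (fun x' => F n x' = F n x) ≤ ε n

/-! ### Subspaces of `ℤ₂^k` -/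

/-- The space `ℤ₂^k`. -/
abbrev Vec (k : ℕ) : Type := Fin k → ZMod 2

/-- A bit string of length `k`, as a vector of `ℤ₂^k`. -/
def toVec {k : ℕ} (b : Fin k → Bool) : Vec k := fun i => if b i then 1 else 0

/-- The dual subspace `T^⊥`, with respect to the standard dot product. -/
def perp {k : ℕ} (T : Submodule (ZMod 2) (Vec k)) : Submodule (ZMod 2) (Vec k) :=
  T.orthogonalBilin (dotProductBilin (ZMod 2) (ZMod 2))

theorem mem_perp {k : ℕ} (T : Submodule (ZMod 2) (Vec k)) (u : Vec k) :
    u ∈ perp T ↔ ∀ v ∈ T, v ⬝ᵥ u = 0 := Iff.rfl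

/-- The set of subspaces `T` of dimension `d` with `S ⊆ T ⊆ ℤ₂^k`. -/
noncomputable def superspaces {k : ℕ} (S : Submodule (ZMod 2) (Vec k)) (d : ℕ) :
    Finset (Submodule (ZMod 2) (Vec k)) :=
  (Set.toFinite {T | S ≤ T ∧ Module.finrank (ZMod 2) T = d}).toFinset

/-- A choice of a polynomial-size circuit checking membership in each subspace of each `ℤ₂^k`. -/
structure IsMembershipFamily
    (CM : (k : ℕ) → Submodule (ZMod 2) (Vec k) → BoolCircuit k 1) : Prop where
  correct : ∀ k T (b : Fin k → Bool), (CM k T).eval b 0 = true ↔ toVec b ∈ T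
  efficient : ∃ Q : Polynomial ℕ, ∀ k T, (CM k T).size ≤ Q.eval k

/-- The probability that `E T u` holds, where `T` is a uniformly random superspace of `S` of dimension
`d` and `u` is the output of `A` on a random obfuscation of the membership circuit of `T`. -/
noncomputable def superspaceExperiment (iO : Obfuscator)
    (CM : (k : ℕ) → Submodule (ZMod 2) (Vec k) → BoolCircuit k 1) (κ p : ℕ) {k : ℕ}
    (S : Submodule (ZMod 2) (Vec k)) (d : ℕ) (A : QCircuit k)
    (E : Submodule (ZMod 2) (Vec k) → Vec k → Prop) : ℝ :=
  𝔼 T ∈ superspaces S d, iO.probOn κ p (CM k T) A (fun b => E T (toVec b))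

end DualSubspace

open DualSubspace

/-! The proof turns an algorithm `A` that violates the conclusion into an inverter of the one-way
function `F`, which cannot exist.

Given `y = F z`, a superspace of `S` that depends on `z` is hidden behind `y`. Let `L` be a
uniformly random surjection from `ℤ₂^k` to `ℤ₂^lam × ℤ₂^c` that vanishes on `S`, where `lam + c =
t + 1`, and let `T` be the preimage under `L` of the line of `(z, 0)`. Since the automorphisms of
`ℤ₂^k` that fix `S` act transitively on the superspaces of `S` of a given dimension, `T` is a
uniformly random superspace of dimension `r + s` (`expect_surjections`). As `F` is injective,
membership of `v` in `T` can be tested knowing only `y`: the vector `L v` is zero, or it is `(z',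
0)` with `F z' = y` (`pointTest_eq_true`). The circuit for this test computes the same function as
the membership circuit of `T`, so the two obfuscations are indistinguishable
(`abs_probOn_pointTest_sub_le`).

An output `u` of `A` is said to hit at `b` if it is orthogonal to the kernel of `L` and the
functional on the target of `L` that it induces is one at `b`. If `u` hits at `(z, 0)`, then `u`
lies in `S^⊥` but not in `T^⊥`; by assumption this happens with probability less than `ε / (16 k
(t + 1))`. If `u` is a nonzero vector of `T^⊥`, then for every `b` outside the line of `(z, 0)` it
hits at `b` with probability at least one half over the choice of `L` given `T`, as is seen by
composing `L` with transvections that fix `(z, 0)` (`sum_perp_le_two_mul_sum_hits`). Hence every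
point `(b, 0)` other than zero and `(z, 0)` is hit with probability at least about `ε / 2`. With
about `6 (t + 1) / ε` independent samples, a union bound over the at most `2 ^ lam` points `b`
shows that, with probability at least one half, no output hits at `(z, 0)` while every other
nonzero `(b, 0)` is hit by some output (`le_expect_recover`, `failure_le_half`). In this case `z`
is the only nonzero vector that is orthogonal to all decoded outputs, and Gaussian elimination
finds it (`sum_elim_eq`).

Two points concern the size of the inverter. The elimination is carried out one output at a time,
so its cost is linear in the number of samples, as the second numerical hypothesis demands. The
surjections and the coins of the obfuscator are hardwired (`inversion_bound`), and the circuits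
that have to be obfuscated depend on `y` only through a string of hardwired bits, so their
descriptions cost next to nothing (`exists_pointTest_circuit`). Classical computations are counted
in `GateCost`, which identifies a wire with the Boolean function that it carries, and are run
reversibly around `N` parallel copies of `A` with all measurements deferred to the end
(`QCircuit.exists_parallel`).
-/

namespace DualSubspace

/-! ### Sums over bit strings -/

/-- Overwriting the bit `i` by a uniformly random bit preserves sums over all bit strings. -/
theorem sum_sum_update {ι M : Type*} [Fintype ι] [DecidableEq ι] [AddCommMonoid M] (i : ι)
    (g : (ι → Bool) → M) :
    ∑ x : ι → Bool, ∑ b : Bool, g (Function.update x i b) = 2 • ∑ x, g x := by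
  have h : ∑ p : (ι → Bool) × Bool, g (Function.update p.1 i p.2)
      = ∑ p : (ι → Bool) × Bool, g p.1 := by
    refine Fintype.sum_bijective (fun p => (Function.update p.1 i p.2, p.1 i)) ?_ _ _ (fun p => rfl)
    apply Function.Involutive.bijective
    rintro ⟨x, b⟩
    simp
  rw [← Fintype.sum_prod_type' (f := fun x b => g (Function.update x i b)), h,
    Fintype.sum_prod_type]
  simp [Finset.smul_sum]

/-! ### Unitarity -/

theorem sum_normSq_unitary (U : Matrix.unitaryGroup Bool ℂ) (a : Bool → ℂ) :
    ∑ b, ‖∑ c, (U : Matrix Bool Bool ℂ) b c * a c‖ ^ 2 = ∑ c, ‖a c‖ ^ 2 := by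
  have key : ∀ v : Bool → ℂ, ((∑ c, ‖v c‖ ^ 2 : ℝ) : ℂ) = star v ⬝ᵥ v := by
    intro v
    simp only [dotProduct, Pi.star_apply, RCLike.star_def, Complex.ofReal_sum, Complex.ofReal_pow]
    refine Finset.sum_congr rfl fun c _ => ?_
    rw [Complex.conj_mul']
  have hU : star (U : Matrix Bool Bool ℂ) * (U : Matrix Bool Bool ℂ) = 1 :=
    Matrix.UnitaryGroup.star_mul_self U
  apply Complex.ofReal_injective
  have h2 := key ((U : Matrix Bool Bool ℂ).mulVec a)
  simp only [Matrix.mulVec, dotProduct] at h2 ⊢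
  rw [h2, key a]
  change star ((U : Matrix Bool Bool ℂ).mulVec a) ⬝ᵥ ((U : Matrix Bool Bool ℂ).mulVec a) = _
  rw [Matrix.star_mulVec, ← Matrix.dotProduct_mulVec, Matrix.mulVec_mulVec,
    ← Matrix.star_eq_conjTranspose, hU, Matrix.one_mulVec]

theorem update_xor_involutive {ι : Type*} [DecidableEq ι] (t : ι) (f : (ι → Bool) → Bool)
    (hf : ∀ x b, f (Function.update x t b) = f x) :
    Function.Involutive (fun x : ι → Bool => Function.update x t (xor (x t) (f x))) := by
  intro x
  simp [hf]

/-- Every elementary gate preserves the total squared amplitude. -/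
theorem QGate.sum_normSq_apply {w : ℕ} (g : QGate w) (ψ : (Fin w → Bool) → ℂ) :
    ∑ x, ‖g.apply ψ x‖ ^ 2 = ∑ x, ‖ψ x‖ ^ 2 := by
  cases g with
  | single U i =>
    have h := fun φ : (Fin w → Bool) → ℂ => sum_sum_update i (fun x => ‖φ x‖ ^ 2)
    have h1 := h (QGate.apply (.single U i) ψ)
    have h2 := h ψ
    simp only [QGate.apply, Function.update_idem, Function.update_self] at h1 ⊢
    have h3 : ∀ x : Fin w → Bool, ∑ b, ‖∑ c, (U : Matrix Bool Bool ℂ) b c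
        * ψ (Function.update x i c)‖ ^ 2 = ∑ c, ‖ψ (Function.update x i c)‖ ^ 2 := fun x =>
      sum_normSq_unitary U (fun c => ψ (Function.update x i c))
    simp only [h3] at h1
    rw [h2] at h1
    simpa using h1.symm
  | cnot c t h =>
    exact Function.Bijective.sum_comp (update_xor_involutive t (fun x => x c)
      (fun x b => by simp [h])).bijective (fun x => ‖ψ x‖ ^ 2)
  | toffoli a b t hab ha hb =>
    exact Function.Bijective.sum_comp (update_xor_involutive t (fun x => x a && x b)
      (fun x b => by simp [ha, hb])).bijective (fun x => ‖ψ x‖ ^ 2)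

theorem QCircuit.sum_normSq_finalState {m : ℕ} (A : QCircuit m) (x : List Bool) :
    ∑ v, ‖A.finalState x v‖ ^ 2 = 1 := by
  have h : ∀ (l : List (QGate A.wires)) (ψ : (Fin A.wires → Bool) → ℂ),
      ∑ v, ‖l.foldl (fun ψ g => g.apply ψ) ψ v‖ ^ 2 = ∑ v, ‖ψ v‖ ^ 2 := by
    intro l
    induction l with
    | nil => intro ψ; rfl
    | cons g l ih => intro ψ; rw [List.foldl_cons, ih, g.sum_normSq_apply]
  rw [QCircuit.finalState, h]
  simp [QCircuit.initState, apply_ite]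

theorem QCircuit.prob_mono {m : ℕ} (A : QCircuit m) (x : List Bool)
    {E E' : (Fin m → Bool) → Prop} (h : ∀ u, E u → E' u) : A.prob x E ≤ A.prob x E' := by
  classical
  refine Finset.sum_le_sum fun v _ => ?_
  by_cases h1 : E (fun j => v (A.out j))
  · simp [h1, h _ h1]
  · simp only [h1, if_false]; split_ifs <;> positivity

theorem QCircuit.prob_true {m : ℕ} (A : QCircuit m) (x : List Bool) :
    A.prob x (fun _ => True) = 1 := by
  simp [QCircuit.prob, A.sum_normSq_finalState x]

theorem QCircuit.prob_le_one {m : ℕ} (A : QCircuit m) (x : List Bool)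
    (E : (Fin m → Bool) → Prop) : A.prob x E ≤ 1 :=
  (A.prob_mono x (fun _ _ => trivial)).trans_eq (A.prob_true x)

/-! ### Gate lists acting as permutations of the computational basis -/

/-- The action of a list of elementary gates on a vector of amplitudes. -/
noncomputable def applyGates {w : ℕ} (l : List (QGate w)) (ψ : (Fin w → Bool) → ℂ) :
    (Fin w → Bool) → ℂ :=
  l.foldl (fun ψ g => g.apply ψ) ψ

theorem applyGates_append {w : ℕ} (l l' : List (QGate w)) (ψ : (Fin w → Bool) → ℂ) :
    applyGates (l ++ l') ψ = applyGates l' (applyGates l ψ) := by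
  simp [applyGates]

/-- The gates `l` permute the computational basis by `σ`. -/
def Permutes {w : ℕ} (l : List (QGate w)) (σ : Equiv.Perm (Fin w → Bool)) : Prop :=
  ∀ ψ v, applyGates l ψ (σ v) = ψ v

theorem Permutes.nil {w : ℕ} : Permutes ([] : List (QGate w)) (Equiv.refl _) := fun _ _ => rfl

theorem Permutes.append {w : ℕ} {l l' : List (QGate w)} {σ σ' : Equiv.Perm (Fin w → Bool)}
    (h : Permutes l σ) (h' : Permutes l' σ') : Permutes (l ++ l') (σ.trans σ') := by
  intro ψ v
  rw [applyGates_append, Equiv.trans_apply, h', h]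

/-- The permutation of the basis that adds to the wire `t` a function of the other wires. -/
def xorPerm {w : ℕ} (t : Fin w) (f : (Fin w → Bool) → Bool)
    (hf : ∀ x b, f (Function.update x t b) = f x) : Equiv.Perm (Fin w → Bool) :=
  (update_xor_involutive t f hf).toPerm

theorem xorPerm_apply {w : ℕ} (t : Fin w) (f : (Fin w → Bool) → Bool)
    (hf : ∀ x b, f (Function.update x t b) = f x) (v : Fin w → Bool) :
    xorPerm t f hf v = Function.update v t (xor (v t) (f v)) := rfl

theorem permutes_of_apply {w : ℕ} {g : QGate w} {t : Fin w} {f : (Fin w → Bool) → Bool}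
    (hf : ∀ x b, f (Function.update x t b) = f x)
    (h : ∀ ψ v, g.apply ψ v = ψ (Function.update v t (xor (v t) (f v)))) :
    Permutes [g] (xorPerm t f hf) := by
  intro ψ v
  change g.apply ψ _ = _
  rw [h]
  exact congrArg ψ (update_xor_involutive t f hf v)

/-- The Pauli `X` gate. -/
noncomputable def pauliX : Matrix.unitaryGroup Bool ℂ :=
  ⟨Matrix.of fun a b => if a = b then 0 else 1, by
    rw [Matrix.mem_unitaryGroup_iff]
    ext a b
    cases a <;> cases b <;> simp [Matrix.mul_apply]⟩

theorem permutes_not {w : ℕ} (t : Fin w) :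
    Permutes [.single pauliX t] (xorPerm t (fun _ => true) (fun _ _ => rfl)) := by
  refine permutes_of_apply _ fun ψ v => ?_
  cases h : v t <;> simp [QGate.apply, pauliX, h]

theorem permutes_cnot {w : ℕ} (c t : Fin w) (h : c ≠ t) :
    Permutes [.cnot c t h] (xorPerm t (fun x => x c) (fun x b => by simp [h])) :=
  permutes_of_apply _ fun _ _ => rfl

theorem permutes_toffoli {w : ℕ} (a b t : Fin w) (hab : a ≠ b) (ha : a ≠ t) (hb : b ≠ t) :
    Permutes [.toffoli a b t hab ha hb]
      (xorPerm t (fun x => x a && x b) (fun x b => by simp [ha, hb])) :=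
  permutes_of_apply _ fun _ _ => rfl

/-- Two elementary gates write the NAND of two wires to a fresh wire. -/
theorem exists_permutes_nand {w : ℕ} (a b t : Fin w) (ha : a ≠ t) (hb : b ≠ t) :
    ∃ (l : List (QGate w)) (σ : Equiv.Perm (Fin w → Bool)), l.length = 2 ∧ Permutes l σ ∧
      ∀ v, v t = false → σ v = Function.update v t (!(v a && v b)) := by
  by_cases hab : a = b
  · subst hab
    refine ⟨_, _, ?_, (permutes_cnot a t ha).append (permutes_not t), ?_⟩
    · rfl
    · intro v hv
      simp [xorPerm_apply, hv]
  · refine ⟨_, _, ?_, (permutes_toffoli a b t hab ha hb).append (permutes_not t), ?_⟩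
    · rfl
    · intro v hv
      simp [xorPerm_apply, hv]

/-- A list of CNOT gates copies wires to fresh wires. -/
theorem exists_permutes_copy {w : ℕ} {κ : Type*} [DecidableEq κ] (src tgt : κ → Fin w)
    (hinj : Function.Injective tgt) (hne : ∀ i j, src i ≠ tgt j) (L : List κ) (hL : L.Nodup) :
    ∃ (l : List (QGate w)) (σ : Equiv.Perm (Fin w → Bool)), l.length = L.length ∧ Permutes l σ ∧
      ∀ v, (∀ i, σ v (tgt i) = if i ∈ L then xor (v (tgt i)) (v (src i)) else v (tgt i)) ∧
        ∀ j, (∀ i, j ≠ tgt i) → σ v j = v j := by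
  induction L with
  | nil => exact ⟨[], _, rfl, Permutes.nil, fun v => ⟨fun i => by simp, fun j _ => rfl⟩⟩
  | cons a L ih =>
    rw [List.nodup_cons] at hL
    obtain ⟨l, σ, hl, hσ, h⟩ := ih hL.2
    refine ⟨_, _, ?_, hσ.append (permutes_cnot (src a) (tgt a) (hne a a)), fun v => ⟨fun i => ?_,
      fun j hj => ?_⟩⟩
    · simp [hl]
    · have hs := (h v).2 (src a) (fun i => hne a i)
      by_cases hi : i = a
      · subst hi
        simp [xorPerm_apply, (h v).1, hL.1, hs]
      · simp [xorPerm_apply, (h v).1, hi, hinj.ne hi]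
    · simp [xorPerm_apply, (h v).2 j hj, hj a]

/-! ### NAND programs as quantum gates -/

/-- The wire values produced by a list of NAND gates, started on the values `x`. -/
def runNand (gs : List (ℕ × ℕ)) (x : List Bool) : List Bool :=
  gs.foldl (fun w g => w ++ [!(w.getD g.1 false && w.getD g.2 false)]) x

theorem runNand_append_singleton (gs : List (ℕ × ℕ)) (g : ℕ × ℕ) (x : List Bool) :
    runNand (gs ++ [g]) x = runNand gs x ++
      [!((runNand gs x).getD g.1 false && (runNand gs x).getD g.2 false)] := by
  simp [runNand]

theorem length_runNand (gs : List (ℕ × ℕ)) (x : List Bool) :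
    (runNand gs x).length = x.length + gs.length := by
  induction gs using List.reverseRecOn with
  | nil => rfl
  | append_singleton gs g ih => rw [runNand_append_singleton]; simp [ih]; ring

/-- `f` is computed by a list of at most `s` NAND gates, on inputs ordered by `e`. -/
def NandComputable {α β : Type*} {n : ℕ} (e : α ≃ Fin n) (s : ℕ)
    (f : (α → Bool) → (β → Bool)) : Prop :=
  ∃ (gs : List (ℕ × ℕ)) (out : β → ℕ), gs.length ≤ s ∧
    ∀ x b, (runNand gs (List.ofFn (x ∘ e.symm))).getD (out b) false = f x b

/-- A list of NAND gates is carried out on qubits: wire `i` is kept on qubit `pos i`, and the qubits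
of the wires created by the gates are fresh. The input wires may share qubits. -/
theorem exists_permutes_runNand {w : ℕ} (n : ℕ) (gs : List (ℕ × ℕ)) (pos : ℕ → Fin w)
    (zero : Fin w)
    (hpos : ∀ i j, i < j → n ≤ j → j < n + gs.length → pos i ≠ pos j)
    (hzero : ∀ j, n ≤ j → j < n + gs.length → zero ≠ pos j) :
    ∃ (l : List (QGate w)) (σ : Equiv.Perm (Fin w → Bool)),
      l.length = 2 * gs.length ∧ Permutes l σ ∧
      ∀ (v : Fin w → Bool) (x : List Bool), x.length = n →
        (∀ i < n, v (pos i) = x.getD i false) →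
        (∀ j, n ≤ j → j < n + gs.length → v (pos j) = false) → v zero = false →
        (∀ i < n + gs.length, σ v (pos i) = (runNand gs x).getD i false) ∧
        ∀ j, (∀ i, n ≤ i → i < n + gs.length → j ≠ pos i) → σ v j = v j := by
  induction gs using List.reverseRecOn with
  | nil =>
    refine ⟨[], _, rfl, Permutes.nil, fun v x hx h1 h2 h3 => ⟨fun i hi => ?_, fun j _ => rfl⟩⟩
    exact h1 i (by simpa using hi)
  | append_singleton gs g ih =>
    simp only [List.length_append, List.length_singleton] at hpos hzero ⊢
    obtain ⟨l, σ, hl, hσ, H⟩ := ih (fun i j h h' h'' => hpos i j h h' (by omega))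
      (fun j h h' => hzero j h (by omega))
    -- a reference to a wire that does not exist reads the qubit `zero`
    set rd : ℕ → Fin w := fun i => if i < n + gs.length then pos i else zero with hrd
    set t : Fin w := pos (n + gs.length) with ht
    have hrdt : ∀ i, rd i ≠ t := by
      intro i
      simp only [hrd]
      split_ifs with h
      · exact hpos i _ h (by omega) (by omega)
      · exact hzero _ (by omega) (by omega)
    obtain ⟨l', σ', hl', hσ', H'⟩ := exists_permutes_nand (rd g.1) (rd g.2) t (hrdt _) (hrdt _)
    refine ⟨l ++ l', σ.trans σ', by simp [hl, hl']; ring, hσ.append hσ', ?_⟩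
    intro v x hx h1 h2 h3
    obtain ⟨K1, K2⟩ := H v x hx h1 (fun j h h' => h2 j h (by omega)) h3
    have hlen : (runNand gs x).length = n + gs.length := by rw [length_runNand, hx]
    have hz : σ v zero = false := by
      rw [K2 zero (fun i h h' => hzero i h (by omega)), h3]
    have hread : ∀ i, σ v (rd i) = (runNand gs x).getD i false := by
      intro i
      simp only [hrd]
      split_ifs with h
      · exact K1 i h
      · rw [hz, List.getD_eq_default _ _ (by omega)]
    have htv : σ v t = false := by
      rw [K2 t (fun i h h' => (hpos i _ h' (by omega) (by omega)).symm), ht,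
        h2 _ (by omega) (by omega)]
    rw [Equiv.trans_apply, H' _ htv, hread, hread, runNand_append_singleton]
    constructor
    · intro i hi
      rcases Nat.lt_succ_iff_lt_or_eq.mp (show i < (n + gs.length) + 1 by omega) with h | h
      · rw [Function.update_of_ne (hpos i _ h (by omega) (by omega)), K1 i h,
          List.getD_append _ _ _ _ (by omega)]
      · subst h
        rw [Function.update_self, List.getD_append_right _ _ _ _ (by omega)]
        simp [hlen]
    · intro j hj
      rw [Function.update_of_ne (hj _ (by omega) (by omega))]
      exact K2 j fun i h h' => hj i h (by omega)

/-! ### Running a circuit on a register -/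

/-- The gate `g` carried out on the qubits of a register. -/
def QGate.map {w W : ℕ} (j : Fin w ↪ Fin W) : QGate w → QGate W
  | .single U i => .single U (j i)
  | .cnot c t h => .cnot (j c) (j t) (j.injective.ne h)
  | .toffoli a b t hab ha hb =>
    .toffoli (j a) (j b) (j t) (j.injective.ne hab) (j.injective.ne ha) (j.injective.ne hb)

theorem QGate.apply_map {w W : ℕ} (j : Fin w ↪ Fin W) (g : QGate w) (φ : (Fin w → Bool) → ℂ)
    (χ : (Fin W → Bool) → ℂ) (hχ : ∀ v i b, χ (Function.update v (j i) b) = χ v) :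
    (g.map j).apply (fun v => φ (v ∘ j) * χ v) = fun v => g.apply φ (v ∘ j) * χ v := by
  have h : ∀ (v : Fin W → Bool) i b,
      Function.update v (j i) b ∘ j = Function.update (v ∘ j) i b := fun v i b =>
    Function.update_comp_eq_of_injective v j.injective i b
  funext v
  cases g with
  | single U i => simp [QGate.map, QGate.apply, h, hχ]; ring
  | cnot c t _ => simp [QGate.map, QGate.apply, h, hχ]
  | toffoli a b t _ _ _ => simp [QGate.map, QGate.apply, h, hχ]

theorem applyGates_map {w W : ℕ} (j : Fin w ↪ Fin W) (l : List (QGate w)) (φ : (Fin w → Bool) → ℂ)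
    (χ : (Fin W → Bool) → ℂ) (hχ : ∀ v i b, χ (Function.update v (j i) b) = χ v) :
    applyGates (l.map (QGate.map j)) (fun v => φ (v ∘ j) * χ v)
      = fun v => applyGates l φ (v ∘ j) * χ v := by
  induction l generalizing φ with
  | nil => rfl
  | cons g l ih =>
    change applyGates (l.map (QGate.map j)) ((g.map j).apply _) = _
    rw [QGate.apply_map j g φ χ hχ, ih]
    rfl

/-- Running the gates `l` on each of several disjoint registers preserves product states. -/
theorem applyGates_flatMap {w W N : ℕ} (reg : Fin N → Fin w ↪ Fin W)
    (hreg : ∀ i i' j j', i ≠ i' → reg i j ≠ reg i' j') (l : List (QGate w))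
    (φ : Fin N → (Fin w → Bool) → ℂ) (χ : (Fin W → Bool) → ℂ)
    (hχ : ∀ v i j b, χ (Function.update v (reg i j) b) = χ v) (L : List (Fin N)) (hL : L.Nodup) :
    applyGates (L.flatMap fun i => l.map (QGate.map (reg i)))
        (fun v => (∏ i, φ i (v ∘ reg i)) * χ v)
      = fun v => (∏ i, (if i ∈ L then applyGates l (φ i) else φ i) (v ∘ reg i)) * χ v := by
  induction L generalizing φ with
  | nil => simp [applyGates]
  | cons a L ih =>
    rw [List.nodup_cons] at hL
    have h1 : (fun v : Fin W → Bool => (∏ i, φ i (v ∘ reg i)) * χ v)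
        = fun v => φ a (v ∘ reg a) * ((∏ i ∈ Finset.univ.erase a, φ i (v ∘ reg i)) * χ v) := by
      funext v
      rw [← mul_assoc, Finset.mul_prod_erase _ (fun i => φ i (v ∘ reg i)) (Finset.mem_univ a)]
    have hcomp : ∀ (v : Fin W → Bool) i j b, i ≠ a →
        Function.update v (reg a j) b ∘ reg i = v ∘ reg i := by
      intro v i j b hi
      funext j'
      simp [hreg i a j' j hi]
    rw [List.flatMap_cons, applyGates_append, h1,
      applyGates_map (reg a) l (φ a) _ (fun v j b => by
        rw [hχ]
        congr 1
        refine Finset.prod_congr rfl fun i hi => ?_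
        rw [hcomp v i j b (Finset.ne_of_mem_erase hi)])]
    have h2 : (fun v : Fin W → Bool => applyGates l (φ a) (v ∘ reg a)
          * ((∏ i ∈ Finset.univ.erase a, φ i (v ∘ reg i)) * χ v))
        = fun v => (∏ i, Function.update φ a (applyGates l (φ a)) i (v ∘ reg i)) * χ v := by
      funext v
      rw [← mul_assoc, ← Finset.mul_prod_erase _ _ (Finset.mem_univ a), Function.update_self]
      congr 2
      refine Finset.prod_congr rfl fun i hi => ?_
      rw [Function.update_of_ne (Finset.ne_of_mem_erase hi)]
    rw [h2, ih _ hL.2]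
    funext v
    congr 1
    refine Finset.prod_congr rfl fun i _ => ?_
    by_cases hi : i = a
    · subst hi; simp [hL.1]
    · simp [hi]

theorem applyGates_basis {w : ℕ} {l : List (QGate w)} {σ : Equiv.Perm (Fin w → Bool)}
    (h : Permutes l σ) (v₀ : Fin w → Bool) :
    applyGates l (fun v => if v = v₀ then 1 else 0) = fun v => if v = σ v₀ then 1 else 0 := by
  funext v
  obtain ⟨v, rfl⟩ := σ.surjective v
  rw [h]
  simp

/-- The input wires followed by further wires `κ`, numbered so that the latter start as zeros. -/
theorem exists_wire_numbering (a : ℕ) (κ : Type*) [Fintype κ] :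
    ∃ (W : ℕ) (e : Fin a ⊕ κ ≃ Fin W), ∀ x : Fin a → Bool,
      (∀ i, bits W (List.ofFn x) (e (.inl i)) = x i) ∧
        ∀ i, bits W (List.ofFn x) (e (.inr i)) = false := by
  refine ⟨a + Fintype.card κ,
    (Equiv.sumCongr (Equiv.refl _) (Fintype.equivFin κ)).trans finSumFinEquiv, fun x => ⟨?_, ?_⟩⟩
  · intro i
    simp [bits, finSumFinEquiv_apply_left]
  · intro i
    simp [bits, finSumFinEquiv_apply_right]

open Classical in
/-- Composition of a quantum algorithm with classical pre- and postprocessing: from the input `x`,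
a NAND program computes `N` strings, `A` is run on each of them on a register of its own, and a NAND
program computes the output from the `N` outputs. All measurements are deferred to the end, which is
sound since the postprocessing permutes the computational basis. -/
theorem QCircuit.exists_parallel {a b d k N s₁ s₃ : ℕ} (A : QCircuit k)
    (G : (Fin a → Bool) → Fin N → Fin d → Bool)
    (hG : NandComputable (Equiv.refl (Fin a)) s₁ (fun x (p : Fin N × Fin d) => G x p.1 p.2))
    (H : (Fin N → Fin k → Bool) → Fin b → Bool)
    (hH : NandComputable finProdFinEquiv s₃
      (fun u : Fin N × Fin k → Bool => H (fun i j => u (i, j)))) :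
    ∃ B : QCircuit b, B.size ≤ 2 * s₁ + N * d + N * A.size + 2 * s₃ ∧
      ∀ (x : Fin a → Bool) (E : (Fin b → Bool) → Prop),
        B.prob (List.ofFn x) E = ∑ r : Fin N → Fin A.wires → Bool,
          if E (H fun i j => r i (A.out j)) then
            ∏ i, ‖A.finalState (List.ofFn (G x i)) (r i)‖ ^ 2 else 0 := by
  classical
  obtain ⟨gs₁, out₁, hs₁, hG⟩ := hG
  obtain ⟨gs₃, out₃, hs₃, hH⟩ := hH
  -- the qubits: the input, a qubit that stays zero, the wires of the first program, the registers,
  -- and the wires of the second program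
  obtain ⟨W, e, he⟩ := exists_wire_numbering a
    (Unit ⊕ Fin gs₁.length ⊕ (Fin N × Fin A.wires) ⊕ Fin gs₃.length)
  let zero : Fin W := e (.inr (.inl ()))
  let w₁ : Fin gs₁.length → Fin W := fun i => e (.inr (.inr (.inl i)))
  let rg : Fin N → Fin A.wires → Fin W := fun i j => e (.inr (.inr (.inr (.inl (i, j)))))
  let w₃ : Fin gs₃.length → Fin W := fun i => e (.inr (.inr (.inr (.inr i))))
  let pos₁ : ℕ → Fin W := fun i =>
    if h : i < a then e (.inl ⟨i, h⟩)
    else if h' : i < a + gs₁.length then w₁ ⟨i - a, by omega⟩ else zero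
  let pos₃ : ℕ → Fin W := fun i =>
    if h : i < N * k then
      rg (finProdFinEquiv.symm ⟨i, h⟩).1 (A.out (finProdFinEquiv.symm ⟨i, h⟩).2)
    else if h' : i < N * k + gs₃.length then w₃ ⟨i - N * k, by omega⟩ else zero
  obtain ⟨l₁, σ₁, hl₁, hσ₁, H₁⟩ := exists_permutes_runNand a gs₁ pos₁ zero
    (by
      intro i j hij hj hj'
      by_cases hi : i < a
      · simp [pos₁, w₁, hi, hj', Nat.not_lt.mpr hj]
      · simp [pos₁, w₁, hi, hj', Nat.not_lt.mpr hj, show i < a + gs₁.length by omega]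
        omega)
    (by
      intro j hj hj'
      simp [pos₁, zero, w₁, hj', Nat.not_lt.mpr hj])
  obtain ⟨l₃, σ₃, hl₃, hσ₃, H₃⟩ := exists_permutes_runNand (N * k) gs₃ pos₃ zero
    (by
      intro i j hij hj hj'
      by_cases hi : i < N * k
      · simp [pos₃, rg, w₃, hi, hj', Nat.not_lt.mpr hj]
      · simp [pos₃, w₃, hi, hj', Nat.not_lt.mpr hj, show i < N * k + gs₃.length by omega]
        omega)
    (by
      intro j hj hj'
      simp [pos₃, zero, w₃, hj', Nat.not_lt.mpr hj])
  let κ' := Fin N × Fin (min d A.wires)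
  let src : κ' → Fin W := fun p => pos₁ (out₁ (p.1, p.2.castLE (min_le_left _ _)))
  let tgt : κ' → Fin W := fun p => rg p.1 (p.2.castLE (min_le_right _ _))
  have hsrc : ∀ (n : ℕ) i j, pos₁ n ≠ rg i j := by
    intro n i j
    simp only [pos₁, zero, w₁, rg]
    split_ifs <;> simp
  obtain ⟨lc, σc, hlc, hσc, Hc⟩ := exists_permutes_copy src tgt
    (by
      rintro ⟨i, j⟩ ⟨i', j'⟩ h
      simp only [tgt, rg, e.injective.eq_iff, Sum.inr.injEq, Sum.inl.injEq, Prod.mk.injEq] at h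
      exact Prod.ext h.1 (Fin.castLE_injective _ h.2))
    (fun i j => hsrc _ _ _)
    (Finset.univ : Finset κ').toList (Finset.nodup_toList _)
  let reg : Fin N → Fin A.wires ↪ Fin W := fun i => ⟨rg i, fun j j' h => by
    simpa [rg] using h⟩
  let lA := (List.finRange N).flatMap fun i => A.gates.map (QGate.map (reg i))
  refine ⟨⟨W, l₁ ++ lc ++ lA ++ l₃, fun b => pos₃ (out₃ b)⟩, ?_, ?_⟩
  · have h1 : lc.length ≤ N * d := by
      rw [hlc, Finset.length_toList, Finset.card_univ, Fintype.card_prod, Fintype.card_fin,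
        Fintype.card_fin]
      exact Nat.mul_le_mul_left _ (min_le_left _ _)
    have h2 : lA.length = N * A.size := by
      simp [lA, List.length_flatMap, QCircuit.size]
    simp only [QCircuit.size, List.length_append] at h2 ⊢
    omega
  · intro x E
    -- the basis state after the preprocessing
    let v₀ : Fin W → Bool := bits W (List.ofFn x)
    obtain ⟨hv₀l, hv₀r⟩ : (∀ i, v₀ (e (.inl i)) = x i) ∧ ∀ i, v₀ (e (.inr i)) = false := he x
    let v₁ : Fin W → Bool := σc (σ₁ v₀)
    obtain ⟨K₁, K₁'⟩ := H₁ v₀ (List.ofFn x) (by simp)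
      (by
        intro i hi
        simp [pos₁, hi, hv₀l])
      (by
        intro j hj hj'
        simp [pos₁, w₁, hj', Nat.not_lt.mpr hj, hv₀r])
      (hv₀r _)
    have hσ₁r : ∀ j, (∀ i, j ≠ w₁ i) → σ₁ v₀ j = v₀ j := by
      intro j hj
      refine K₁' j fun i hi hi' => ?_
      simp only [pos₁, Nat.not_lt.mpr hi, hi', dif_pos, dif_neg, not_false_eq_true]
      exact hj _
    have hσ₁pos : ∀ i, σ₁ v₀ (pos₁ i) = (runNand gs₁ (List.ofFn x)).getD i false := by
      intro i
      by_cases hi : i < a + gs₁.length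
      · exact K₁ i hi
      · have : pos₁ i = zero := by
          simp [pos₁, show ¬ i < a by omega, hi]
        rw [this, hσ₁r _ (by simp [zero, w₁]), List.getD_eq_default]
        · exact hv₀r _
        · rw [length_runNand, List.length_ofFn]; omega
    have hv₁ : ∀ j, (∀ i, j ≠ w₁ i) → (∀ i i', j ≠ rg i i') → v₁ j = v₀ j := by
      intro j h h'
      change σc (σ₁ v₀) j = _
      rw [(Hc _).2 j (fun p => h' _ _), hσ₁r j h]
    have hv₁reg : ∀ i j, v₁ (rg i j) = bits A.wires (List.ofFn (G x i)) j := by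
      intro i j
      have h0 : σ₁ v₀ (rg i j) = false := by
        rw [hσ₁r _ (by simp [rg, w₁])]; exact hv₀r _
      by_cases hj : (j : ℕ) < d
      · have h1 := (Hc (σ₁ v₀)).1 (i, ⟨j, lt_min hj j.2⟩)
        have h2 : tgt (i, ⟨j, lt_min hj j.2⟩) = rg i j := rfl
        rw [h2, h0] at h1
        change σc (σ₁ v₀) (rg i j) = _
        rw [h1]
        have h3 := hG x (i, ⟨j, hj⟩)
        simp only [Equiv.refl_symm, Equiv.coe_refl, Function.comp_id] at h3
        simp only [Finset.mem_toList, Finset.mem_univ, if_true, src, hσ₁pos, Bool.false_xor]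
        simpa [bits, hj] using h3
      · change σc (σ₁ v₀) (rg i j) = _
        rw [(Hc _).2 _ (fun p h => hj ?_), h0]
        · simp [bits, hj]
        · simp only [tgt, rg, e.injective.eq_iff, Sum.inr.injEq, Sum.inl.injEq,
            Prod.mk.injEq] at h
          have := p.2.2
          rw [h.2]
          exact lt_of_lt_of_le this (min_le_left _ _)
    let χ : (Fin W → Bool) → ℂ := fun v => if ∀ w, (∀ i j, w ≠ rg i j) → v w = v₁ w then 1 else 0
    have hψ₁ : applyGates (l₁ ++ lc) (fun v => if v = v₀ then 1 else 0)
        = fun v => (∏ i, A.initState (List.ofFn (G x i)) (v ∘ reg i)) * χ v := by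
      rw [applyGates_basis (hσ₁.append hσc)]
      funext v
      change (if v = v₁ then (1 : ℂ) else 0) = _
      simp only [QCircuit.initState, χ]
      rw [Finset.prod_ite_zero, ite_mul, zero_mul, Finset.prod_const_one, one_mul, ← ite_and]
      have hiff : v = v₁ ↔ (∀ i ∈ Finset.univ, v ∘ reg i = bits A.wires (List.ofFn (G x i))) ∧
          ∀ w, (∀ i j, w ≠ rg i j) → v w = v₁ w := by
        refine ⟨fun hv => ⟨fun i _ => funext fun j => (congrFun hv _).trans (hv₁reg i j),
          fun w _ => congrFun hv w⟩, ?_⟩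
        rintro ⟨h1, h2⟩
        funext w
        by_cases hw : ∃ i j, w = rg i j
        · obtain ⟨i, j, hw⟩ := hw
          rw [hw, hv₁reg]
          exact congrFun (h1 i (Finset.mem_univ i)) j
        · push Not at hw
          exact h2 w hw
      by_cases hv : v = v₁
      · rw [if_pos hv, if_pos (hiff.1 hv)]
      · rw [if_neg hv, if_neg (mt hiff.2 hv)]
    have hψ₂ : applyGates (l₁ ++ lc ++ lA) (fun v => if v = v₀ then 1 else 0)
        = fun v => (∏ i, A.finalState (List.ofFn (G x i)) (v ∘ reg i)) * χ v := by
      rw [applyGates_append, hψ₁, applyGates_flatMap reg _ A.gates _ χ _ _ (List.nodup_finRange N)]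
      · funext v
        simp only [List.mem_finRange, if_true]
        rfl
      · intro i i' j j' h
        change rg i j ≠ rg i' j'
        simp [rg, h]
      · intro v i j b
        simp only [χ]
        refine if_congr (forall_congr' fun w => forall_congr' fun hw => ?_) rfl rfl
        rw [Function.update_of_ne (show w ≠ reg i j from hw i j)]
    set ψ₂ := fun v => (∏ i, A.finalState (List.ofFn (G x i)) (v ∘ reg i)) * χ v with hψ₂def
    have hprob : QCircuit.prob ⟨W, l₁ ++ lc ++ lA ++ l₃, fun b => pos₃ (out₃ b)⟩ (List.ofFn x) E
        = ∑ v, if E (fun b => σ₃ v (pos₃ (out₃ b))) then ‖ψ₂ v‖ ^ 2 else 0 := by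
      rw [QCircuit.prob]
      refine (Fintype.sum_equiv σ₃ _ _ fun v => ?_).symm
      have hv : applyGates (l₁ ++ lc ++ lA ++ l₃) (fun v => if v = v₀ then 1 else 0) (σ₃ v)
          = ψ₂ v := by
        rw [applyGates_append, hψ₂, hσ₃]
      rw [← hv]
      rfl
    rw [hprob]
    -- the basis states that agree with the preprocessed state outside the registers
    obtain ⟨ext, hextreg, hext⟩ : ∃ ext : (Fin N → Fin A.wires → Bool) → Fin W → Bool,
        (∀ r i j, ext r (rg i j) = r i j) ∧ ∀ r w, (∀ i j, w ≠ rg i j) → ext r w = v₁ w := by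
      refine ⟨fun r w => Sum.elim (fun _ => v₁ w) (Sum.elim (fun _ => v₁ w) (Sum.elim
        (fun _ => v₁ w) (Sum.elim (fun p => r p.1 p.2) (fun _ => v₁ w)))) (e.symm w), ?_, ?_⟩
      · intro r i j
        simp [rg]
      · intro r w hw
        obtain ⟨y, rfl⟩ := e.surjective w
        rcases y with i | i | i | i | i
        · simp
        · simp
        · simp
        · exact absurd rfl (hw i.1 i.2)
        · simp
    symm
    refine Fintype.sum_of_injective ext ?_ _ _ ?_ ?_
    · intro r r' h
      funext i j
      rw [← hextreg r, h, hextreg]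
    · intro v hv
      have : χ v = 0 := by
        simp only [χ]
        refine if_neg fun h => hv ⟨fun i j => v (rg i j), ?_⟩
        funext w
        by_cases hw : ∃ i j, w = rg i j
        · obtain ⟨i, j, hw⟩ := hw
          rw [hw]
          exact hextreg _ i j
        · push Not at hw
          exact (hext _ _ hw).trans (h w hw).symm
      simp [hψ₂def, this]
    · intro r
      obtain ⟨K₃, K₃'⟩ := H₃ (ext r)
        (List.ofFn ((fun p : Fin N × Fin k => r p.1 (A.out p.2)) ∘ finProdFinEquiv.symm)) (by simp)
        (by
          intro i hi
          simp only [pos₃, hi, dif_pos, hextreg]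
          simp [hi])
        (by
          intro j hj hj'
          simp only [pos₃, hj', Nat.not_lt.mpr hj, dif_pos, dif_neg, not_false_eq_true]
          rw [hext _ _ (by simp [w₃, rg]), hv₁ _ (by simp [w₃, w₁]) (by simp [w₃, rg])]
          exact hv₀r _)
        (by
          rw [hext _ _ (by simp [zero, rg]), hv₁ _ (by simp [zero, w₁]) (by simp [zero, rg])]
          exact hv₀r _)
      have hout : (fun b => σ₃ (ext r) (pos₃ (out₃ b))) = H (fun i j => r i (A.out j)) := by
        funext b
        refine Eq.trans ?_ (hH (fun p => r p.1 (A.out p.2)) b)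
        by_cases hb : out₃ b < N * k + gs₃.length
        · exact K₃ _ hb
        · have hz : pos₃ (out₃ b) = zero := by
            simp [pos₃, show ¬ out₃ b < N * k by omega, hb]
          rw [hz, List.getD_eq_default]
          · rw [K₃' zero (by
                intro i hi hi'
                simp only [pos₃, hi', Nat.not_lt.mpr hi, dif_pos, dif_neg, not_false_eq_true]
                simp [zero, w₃]),
              hext _ _ (by simp [zero, rg]), hv₁ _ (by simp [zero, w₁]) (by simp [zero, rg])]
            exact hv₀r _
          · rw [length_runNand, List.length_ofFn]; omega
      rw [hout]
      refine if_congr Iff.rfl ?_ rfl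
      have hχ : χ (ext r) = 1 := if_pos fun w hw => hext r w hw
      have hr : ∀ i, ext r ∘ reg i = r i := fun i => funext fun j => hextreg r i j
      simp [hψ₂def, hχ, hr, Finset.prod_pow]

/-! ### Gate counts of sets of Boolean functions -/

/-- `Derives A s B`: starting from the functions in `A` and the constant `false`, a sequence of `s`
NAND gates produces the functions in `B`. Wires are identified with the functions of a global input
`X` that they carry, so that no wire numbers are needed. -/
inductive Derives {X : Type*} (A : Set (X → Bool)) : ℕ → Set (X → Bool) → Prop
  | base : Derives A 0 (insert (fun _ => false) A)
  | gate {s : ℕ} {B : Set (X → Bool)} {f g : X → Bool} : Derives A s B → f ∈ B → g ∈ B →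
      Derives A (s + 1) (insert (fun x => !(f x && g x)) B)

/-- All functions in `B` can be computed together from the functions in `A` by at most `s` NAND
gates. -/
def GateCost {X : Type*} (A : Set (X → Bool)) (s : ℕ) (B : Set (X → Bool)) : Prop :=
  ∃ s' ≤ s, ∃ B', Derives A s' B' ∧ B ⊆ B'

section GateCost

variable {X Y : Type*} {A A' B B' C : Set (X → Bool)} {s s' : ℕ} {f g : X → Bool}

theorem Derives.base_subset (h : Derives A s B) : insert (fun _ => false) A ⊆ B := by
  induction h with
  | base => exact subset_rfl
  | gate _ _ _ ih => exact ih.trans (Set.subset_insert _ _)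

theorem Derives.trans (h : Derives A s B) (h' : Derives A' s' C) (hA : A' ⊆ B) :
    ∃ D, Derives A (s + s') D ∧ B ⊆ D ∧ C ⊆ D := by
  induction h' with
  | base =>
    exact ⟨B, h, subset_rfl,
      Set.insert_subset (h.base_subset (Set.mem_insert _ _)) hA⟩
  | gate _ hf hg ih =>
    obtain ⟨D, hD, h1, h2⟩ := ih
    exact ⟨_, hD.gate (h2 hf) (h2 hg), h1.trans (Set.subset_insert _ _),
      Set.insert_subset_insert h2⟩

theorem GateCost.trans_union (h : GateCost A s B) (h' : GateCost (A ∪ B) s' C) :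
    GateCost A (s + s') (B ∪ C) := by
  obtain ⟨t, ht, B', hB, hBB⟩ := h
  obtain ⟨t', ht', C', hC, hCC⟩ := h'
  obtain ⟨D, hD, h1, h2⟩ := hB.trans hC
    (Set.union_subset ((Set.subset_insert _ _).trans hB.base_subset) hBB)
  exact ⟨t + t', by omega, D, hD, Set.union_subset (hBB.trans h1) (hCC.trans h2)⟩

theorem GateCost.mono (h : GateCost A s B) (hA : A ⊆ A') (hs : s ≤ s') (hB : B' ⊆ B) :
    GateCost A' s' B' := by
  obtain ⟨t, ht, D, hD, hDD⟩ := h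
  obtain ⟨D', hD', h1, h2⟩ := Derives.trans (Derives.base (A := A')) hD
    (hA.trans (Set.subset_insert _ _))
  exact ⟨0 + t, by omega, D', hD', hB.trans (hDD.trans h2)⟩

theorem GateCost.trans (h : GateCost A s B) (h' : GateCost B s' C) : GateCost A (s + s') C :=
  (h.trans_union (h'.mono Set.subset_union_right le_rfl subset_rfl)).mono subset_rfl le_rfl
    Set.subset_union_right

theorem GateCost.union (h : GateCost A s B) (h' : GateCost A s' C) :
    GateCost A (s + s') (B ∪ C) :=
  h.trans_union (h'.mono Set.subset_union_left le_rfl subset_rfl)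

theorem GateCost.of_le (h : GateCost A s B) (hs : s ≤ s') : GateCost A s' B :=
  h.mono subset_rfl hs subset_rfl

theorem GateCost.of_subset (h : B ⊆ A) : GateCost A s B :=
  ⟨0, Nat.zero_le _, _, .base, h.trans (Set.subset_insert _ _)⟩

theorem GateCost.of_mem (h : f ∈ A) : GateCost A s {f} :=
  GateCost.of_subset (Set.singleton_subset_iff.mpr h)

theorem GateCost.const_false : GateCost A s {fun _ => false} :=
  ⟨0, Nat.zero_le _, _, .base, Set.singleton_subset_iff.mpr (Set.mem_insert _ _)⟩

theorem GateCost.nand (h : GateCost A s {f, g}) : GateCost A (s + 1) {fun x => !(f x && g x)} := by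
  obtain ⟨t, ht, D, hD, hDD⟩ := h
  have hf : f ∈ D := hDD (by simp)
  have hg : g ∈ D := hDD (by simp)
  exact ⟨t + 1, by omega, _, hD.gate hf hg, Set.singleton_subset_iff.mpr (Set.mem_insert _ _)⟩

theorem GateCost.pair (h : GateCost A s {f}) (h' : GateCost A s' {g}) :
    GateCost A (s + s') {f, g} :=
  h.union h'

theorem GateCost.not (h : GateCost A s {f}) : GateCost A (s + 1) {fun x => !f x} := by
  have h1 : GateCost A s {f, f} := by simpa using h
  simpa using h1.nand

theorem GateCost.const (b : Bool) : GateCost A 1 {fun _ => b} := by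
  cases b
  · exact GateCost.const_false
  · simpa using (GateCost.const_false (A := A) (s := 0)).not

theorem GateCost.and (h : GateCost A s {f}) (h' : GateCost A s' {g}) :
    GateCost A (s + s' + 2) {fun x => f x && g x} := by
  simpa using (h.pair h').nand.not

theorem GateCost.or (h : GateCost A s {f}) (h' : GateCost A s' {g}) :
    GateCost A (s + s' + 3) {fun x => f x || g x} := by
  have := (h.not.pair h'.not).nand
  simp only [Bool.not_and, Bool.not_not] at this
  exact this.of_le (by omega)

theorem GateCost.xor (h : GateCost A s {f}) (h' : GateCost A s' {g}) :
    GateCost A (s + s' + 9) {fun x => Bool.xor (f x) (g x)} := by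
  refine (h.pair h').trans ?_
  have hf : GateCost {f, g} 0 {f} := GateCost.of_mem (by simp)
  have hg : GateCost {f, g} 0 {g} := GateCost.of_mem (by simp)
  have := (hf.and hg.not).or (hf.not.and hg)
  have h2 : (fun x => Bool.xor (f x) (g x)) = fun x => (f x && !g x) || (!f x && g x) := by
    funext x
    cases f x <;> cases g x <;> rfl
  rw [h2]
  exact this

theorem GateCost.forall_mem {ι : Type*} (I : Finset ι) (p : ι → X → Bool)
    (h : ∀ i ∈ I, GateCost A s {p i}) :
    GateCost A (1 + I.card * (s + 2)) {fun x => decide (∀ i ∈ I, p i x = true)} := by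
  classical
  induction I using Finset.induction_on with
  | empty => simpa using GateCost.const true
  | insert a I ha ih =>
    have h1 := (h a (by simp)).and (ih fun i hi => h i (by simp [hi]))
    have h2 : (fun x => decide (∀ i ∈ insert a I, p i x = true))
        = fun x => p a x && decide (∀ i ∈ I, p i x = true) := by
      funext x
      simp [Bool.decide_and]
    rw [h2, Finset.card_insert_of_notMem ha]
    exact h1.of_le (by ring_nf; omega)

/-- An element of `ℤ₂` as a bit. -/
def bitOf (a : ZMod 2) : Bool := decide (a = 1)

theorem bitOf_add (a b : ZMod 2) : bitOf (a + b) = Bool.xor (bitOf a) (bitOf b) := by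
  revert a b; decide

theorem bitOf_mul (a b : ZMod 2) : bitOf (a * b) = (bitOf a && bitOf b) := by
  revert a b; decide

theorem GateCost.sum {ι : Type*} (I : Finset ι) (p : ι → X → ZMod 2)
    (h : ∀ i ∈ I, GateCost A s {fun x => bitOf (p i x)}) :
    GateCost A (I.card * (s + 9)) {fun x => bitOf (∑ i ∈ I, p i x)} := by
  classical
  induction I using Finset.induction_on with
  | empty => simpa [bitOf] using GateCost.const_false (A := A) (s := 0)
  | insert a I ha ih =>
    have h1 := (h a (by simp)).xor (ih fun i hi => h i (by simp [hi]))
    have h2 : (fun x => bitOf (∑ i ∈ insert a I, p i x))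
        = fun x => Bool.xor (bitOf (p a x)) (bitOf (∑ i ∈ I, p i x)) := by
      funext x
      rw [Finset.sum_insert ha, bitOf_add]
    rw [h2, Finset.card_insert_of_notMem ha]
    exact h1.of_le (by ring_nf; omega)

theorem GateCost.iUnion {ι : Type*} [Fintype ι] {F : ι → Set (X → Bool)}
    (h : ∀ i, GateCost A s (F i)) : GateCost A (Fintype.card ι * s) (⋃ i, F i) := by
  classical
  have key : ∀ I : Finset ι, GateCost A (I.card * s) (⋃ i ∈ I, F i) := by
    intro I
    induction I using Finset.induction_on with
    | empty => simpa using GateCost.of_subset (Set.empty_subset A)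
    | insert a I ha ih =>
      rw [Finset.card_insert_of_notMem ha, Finset.set_biUnion_insert]
      exact ((h a).union ih).of_le (by ring_nf; omega)
  simpa using key Finset.univ

theorem GateCost.range {ι : Type*} [Fintype ι] {p : ι → X → Bool}
    (h : ∀ i, GateCost A s {p i}) : GateCost A (Fintype.card ι * s) (Set.range p) := by
  simpa only [Set.iUnion_singleton_eq_range] using GateCost.iUnion h

/-- Wires can be read as functions of another input. -/
theorem GateCost.comap (h : GateCost A s B) (φ : Y → X) :
    GateCost ((· ∘ φ) '' A) s ((· ∘ φ) '' B) := by
  obtain ⟨t, ht, D, hD, hDD⟩ := h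
  refine ⟨t, ht, (· ∘ φ) '' D, ?_, Set.image_mono hDD⟩
  clear hDD ht
  induction hD with
  | base =>
    rw [Set.image_insert_eq]
    exact .base
  | gate _ hf hg ih =>
    rw [Set.image_insert_eq]
    exact ih.gate (Set.mem_image_of_mem _ hf) (Set.mem_image_of_mem _ hg)

end GateCost

/-- The coordinate functions on bit strings. -/
def coords (α : Type*) : Set ((α → Bool) → Bool) := Set.range fun a x => x a

theorem GateCost.comp {α : Type*} {Y : Type*} {A : Set (Y → Bool)} {s s' : ℕ}
    {φ : Y → α → Bool} (h : GateCost A s (Set.range fun a y => φ y a)) {β : Type*}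
    {F : β → (α → Bool) → Bool} (hF : GateCost (coords α) s' (Set.range F)) :
    GateCost A (s + s') (Set.range fun b y => F b (φ y)) := by
  refine h.trans ((hF.comap φ).mono ?_ le_rfl ?_)
  · rintro _ ⟨_, ⟨a, rfl⟩, rfl⟩
    exact ⟨a, rfl⟩
  · rintro _ ⟨b, rfl⟩
    exact ⟨_, ⟨b, rfl⟩, rfl⟩

/-- The functions computed by a circuit have at most the cost of its gates. -/
theorem BoolCircuit.gateCost {n m : ℕ} (C : BoolCircuit n m) :
    GateCost (coords (Fin n)) C.gates.length (Set.range fun j x => C.eval x j) := by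
  have key : ∀ gs : List (ℕ × ℕ), ∃ B, Derives (coords (Fin n)) gs.length B ∧
      ∀ i, (fun x => (runNand gs (List.ofFn x)).getD i false) ∈ B := by
    intro gs
    induction gs using List.reverseRecOn with
    | nil =>
      refine ⟨_, .base, fun i => ?_⟩
      by_cases hi : i < n
      · right
        exact ⟨⟨i, hi⟩, by funext x; simp [runNand, hi]⟩
      · left
        funext x
        simp [runNand, hi]
    | append_singleton gs g ih =>
      obtain ⟨B, hB, h⟩ := ih
      refine ⟨_, by simpa using hB.gate (h g.1) (h g.2), fun i => ?_⟩
      rcases lt_trichotomy i (n + gs.length) with hi | hi | hi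
      · right
        convert h i using 2 with x
        rw [runNand_append_singleton, List.getD_append _ _ _ _ (by simpa [length_runNand] using hi)]
      · left
        funext x
        rw [runNand_append_singleton, List.getD_append_right _ _ _ _ (by simp [length_runNand, hi])]
        simp [length_runNand, hi]
      · right
        convert hB.base_subset (Set.mem_insert _ _) using 2 with x
        rw [List.getD_eq_default]
        simp only [length_runNand, List.length_append, List.length_ofFn, List.length_singleton]
        omega
  obtain ⟨B, hB, h⟩ := key C.gates
  refine ⟨_, le_rfl, B, hB, ?_⟩
  rintro _ ⟨j, rfl⟩
  exact h _

theorem GateCost.nandComputable {α β : Type*} {n : ℕ} (e : α ≃ Fin n) {s : ℕ}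
    {F : β → (α → Bool) → Bool} (h : GateCost (coords α) s (Set.range F)) :
    NandComputable e s (fun x b => F b x) := by
  obtain ⟨t, ht, D, hD, hDD⟩ := h
  have key : ∃ gs : List (ℕ × ℕ), gs.length = t ∧ ∀ f ∈ D, f = (fun _ => false) ∨
      ∃ i < n + t, ∀ x, (runNand gs (List.ofFn (x ∘ e.symm))).getD i false = f x := by
    clear ht hDD
    induction hD with
    | base =>
      refine ⟨[], rfl, ?_⟩
      rintro f (rfl | ⟨a, rfl⟩)
      · exact Or.inl rfl
      · exact Or.inr ⟨e a, by omega, fun x => by simp [runNand]⟩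
    | @gate t D f g _ hf hg ih =>
      obtain ⟨gs, hgs, h⟩ := ih
      have hw : ∀ f ∈ D, ∃ i, ∀ x, (runNand gs (List.ofFn (x ∘ e.symm))).getD i false = f x := by
        intro f hf
        rcases h f hf with rfl | ⟨i, -, hi⟩
        · exact ⟨n + t, fun x => by rw [List.getD_eq_default]; simp [length_runNand, hgs]⟩
        · exact ⟨i, hi⟩
      obtain ⟨i, hi⟩ := hw f hf
      obtain ⟨j, hj⟩ := hw g hg
      refine ⟨gs ++ [(i, j)], by simp [hgs], ?_⟩
      rintro f' (rfl | hf')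
      · refine Or.inr ⟨n + t, by omega, fun x => ?_⟩
        rw [runNand_append_singleton, List.getD_append_right _ _ _ _ (by simp [length_runNand, hgs])]
        simp only [length_runNand, List.length_ofFn, hgs, Nat.sub_self, List.getD_cons_zero, hi, hj]
      · rcases h f' hf' with rfl | ⟨i', hi', h'⟩
        · exact Or.inl rfl
        · refine Or.inr ⟨i', by omega, fun x => ?_⟩
          rw [runNand_append_singleton,
            List.getD_append _ _ _ _ (by simpa [length_runNand, hgs] using hi'), h']
  obtain ⟨gs, hgs, h⟩ := key
  have hw : ∀ b, ∃ i, ∀ x, (runNand gs (List.ofFn (x ∘ e.symm))).getD i false = F b x := by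
    intro b
    rcases h _ (hDD ⟨b, rfl⟩) with h0 | ⟨i, -, hi⟩
    · exact ⟨n + t, fun x => by
        rw [List.getD_eq_default _ _ (by simp [length_runNand, hgs]), h0]⟩
    · exact ⟨i, hi⟩
  choose out hout using hw
  exact ⟨gs, out, by omega, fun x b => hout b x⟩

/-! ### Linear functionals -/

theorem bitOf_toVec {k : ℕ} (b : Fin k → Bool) (i : Fin k) : bitOf (toVec b i) = b i := by
  have h : ∀ b : Bool, decide ((if b then (1 : ZMod 2) else 0) = 1) = b := by decide
  exact h _

theorem GateCost.linear {X : Type*} {A : Set (X → Bool)} {k : ℕ} (ℓ : Vec k →ₗ[ZMod 2] ZMod 2)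
    (φ : X → Fin k → Bool) (h : ∀ i, (fun x => φ x i) ∈ A) :
    GateCost A (9 * k) {fun x => bitOf (ℓ (toVec (φ x)))} := by
  have h1 : ∀ x, ℓ (toVec (φ x)) = ∑ i, toVec (φ x) i * ℓ (Pi.single i 1) := by
    intro x
    conv_lhs => rw [← LinearMap.sum_single_apply (fun _ : Fin k => ZMod 2) (toVec (φ x))]
    rw [map_sum]
    refine Finset.sum_congr rfl fun i _ => ?_
    rw [← smul_eq_mul, ← map_smul, ← Pi.single_smul, smul_eq_mul, mul_one]
  simp only [h1]
  refine (GateCost.sum (s := 0) Finset.univ _ fun i _ => ?_).of_le (by simp [mul_comm])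
  simp only [bitOf_mul, bitOf_toVec]
  cases bitOf (ℓ (Pi.single i 1))
  · simpa using GateCost.const_false
  · simpa using GateCost.of_mem (h i)

theorem GateCost.linear_eq_zero {X : Type*} {A : Set (X → Bool)} {k n : ℕ}
    (ℓ : Fin n → Vec k →ₗ[ZMod 2] ZMod 2) (φ : X → Fin k → Bool) (h : ∀ i, (fun x => φ x i) ∈ A) :
    GateCost A (1 + n * (9 * k + 3)) {fun x => decide (∀ j, ℓ j (toVec (φ x)) = 0)} := by
  have h1 := GateCost.forall_mem Finset.univ (fun j x => !bitOf (ℓ j (toVec (φ x))))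
    fun j _ => (GateCost.linear (ℓ j) φ h).not
  have h2 : ∀ a : ZMod 2, (!bitOf a) = true ↔ a = 0 := by decide
  simpa [h2] using h1

/-! ### Circuits with a hardwired string -/

section ListCost

variable {Y : Type*} {A : Set (Y → Bool)}

/-- The entries of a list of bits that depends on `y` are given by functions of cost at most one. -/
def ListCost (A : Set (Y → Bool)) (ℓ : Y → List Bool) : Prop :=
  ∃ gs : List (Y → Bool), (∀ g ∈ gs, GateCost A 1 {g}) ∧ ∀ y, ℓ y = gs.map fun g => g y

theorem ListCost.append {ℓ ℓ' : Y → List Bool} (h : ListCost A ℓ) (h' : ListCost A ℓ') :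
    ListCost A fun y => ℓ y ++ ℓ' y := by
  obtain ⟨gs, h1, h2⟩ := h
  obtain ⟨gs', h1', h2'⟩ := h'
  refine ⟨gs ++ gs', ?_, fun y => by simp [h2, h2']⟩
  intro g hg
  rcases List.mem_append.mp hg with hg | hg
  exacts [h1 g hg, h1' g hg]

theorem ListCost.const (l : List Bool) : ListCost A fun _ => l := by
  refine ⟨l.map fun b _ => b, ?_, fun y => by simp [Function.comp_def]⟩
  intro g hg
  obtain ⟨b, -, rfl⟩ := List.mem_map.mp hg
  exact GateCost.const b

theorem ListCost.map {ι : Type*} (l : List ι) (f : ι → Y → Bool)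
    (h : ∀ i ∈ l, GateCost A 1 {f i}) : ListCost A fun y => l.map fun i => f i y :=
  ⟨l.map f, by simpa using h, fun y => by simp⟩

theorem ListCost.flatMap {ι : Type*} (l : List ι) (f : ι → Y → List Bool)
    (h : ∀ i ∈ l, ListCost A (f i)) : ListCost A fun y => l.flatMap fun i => f i y := by
  induction l with
  | nil => exact ListCost.const []
  | cons a l ih =>
    simp only [List.flatMap_cons]
    exact (h a (by simp)).append (ih fun i hi => h i (by simp [hi]))

theorem ListCost.getD {ℓ : Y → List Bool} (h : ListCost A ℓ) (n : ℕ) :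
    GateCost A 1 {fun y => (ℓ y).getD n false} := by
  obtain ⟨gs, h1, h2⟩ := h
  by_cases hn : n < gs.length
  · have : (fun y => (ℓ y).getD n false) = gs[n] := by
      funext y
      simp [h2, hn]
    rw [this]
    exact h1 _ (List.getElem_mem hn)
  · have : (fun y => (ℓ y).getD n false) = fun _ => false := by
      funext y
      rw [List.getD_eq_default]
      simpa [h2] using hn
    rw [this]
    exact GateCost.const_false

end ListCost

/-- A circuit on `k` bits that first creates the constant `true` and the bits of `y`, and then
applies the gates `gs`. The wire `p` is used as the constant `false`. -/
def hardwire {m : ℕ} (k p : ℕ) (gs : List (ℕ × ℕ)) (o : ℕ) (y : Fin m → Bool) :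
    BoolCircuit k 1 where
  gates := (p, p) :: (List.ofFn fun j => if y j then (p, p) else (k, k)) ++ gs
  outputs := fun _ => o

theorem hardwire_eval {m k p : ℕ} (gs : List (ℕ × ℕ)) (o : ℕ) (y : Fin m → Bool)
    (hp : k + 1 + m ≤ p) (v : Fin k → Bool) :
    (hardwire k p gs o y).eval v 0 =
      (runNand gs (List.ofFn (Fin.append (Fin.append v fun _ : Fin 1 => true) y))).getD o false := by
  have key : ∀ (l : List Bool) (w : List Bool), k < w.length → w.getD k false = true →
      w.length + l.length ≤ p →
      runNand (l.map fun b => if b then (p, p) else (k, k)) w = w ++ l := by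
    intro l
    induction l with
    | nil => intro w _ _ _; simp [runNand]
    | cons b l ih =>
      intro w hk hw hl
      simp only [List.length_cons] at hl
      have h1 : (w.getD (if b then (p, p) else (k, k)).1 false &&
          w.getD (if b then (p, p) else (k, k)).2 false) = !b := by
        cases b
        · simpa using hw
        · have := List.getD_eq_default w false (show w.length ≤ p by omega)
          simpa using this
      change runNand (l.map _) (w ++ [!(_ && _)]) = _
      rw [h1, Bool.not_not, ih]
      · simp
      · simp; omega
      · rwa [List.getD_append _ _ _ _ hk]
      · simp; omega
  have h0 : (List.ofFn fun j => if y j then (p, p) else (k, k))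
      = (List.ofFn y).map fun b => if b then (p, p) else (k, k) := by
    rw [List.map_ofFn]; rfl
  change (runNand ((p, p) :: (List.ofFn fun j => if y j then (p, p) else (k, k)) ++ gs)
    (List.ofFn v)).getD o false = _
  have h1 : runNand ((p, p) :: (List.ofFn fun j => if y j then (p, p) else (k, k)) ++ gs)
      (List.ofFn v) = runNand gs (runNand ((List.ofFn y).map fun b => if b then (p, p) else (k, k))
        (List.ofFn v ++ [true])) := by
    rw [h0]
    simp [runNand, show ¬ p < k by omega]
  rw [h1, key _ _ (by simp) (by simp) (by simp; omega), List.ofFn_fin_append, List.ofFn_fin_append]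
  simp

theorem hardwire_desc {m : ℕ} (k p : ℕ) (gs : List (ℕ × ℕ)) (o : ℕ) :
    ListCost (coords (Fin m)) fun y => (hardwire k p gs o y).desc p := by
  refine (ListCost.flatMap _ _ fun i _ => ?_).append
    (ListCost.const ((List.finRange 1).flatMap fun _ => BoolCircuit.oneHot p o))
  have h0 : ∀ y : Fin m → Bool, (hardwire k p gs o y).gates
      = ((p, p) :: List.ofFn fun j => if y j then (p, p) else (k, k)) ++ gs := fun _ => rfl
  simp only [h0]
  rcases i with _ | i
  · exact ListCost.const _
  by_cases hi : i < m
  · have h1 : ∀ y : Fin m → Bool,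
        (((p, p) :: List.ofFn fun j => if y j then (p, p) else (k, k)) ++ gs)[i + 1]?
          = some (if y ⟨i, hi⟩ then (p, p) else (k, k)) := by
      intro y
      simp [List.getElem?_append, hi]
    have h2 : ∀ (b : Bool), BoolCircuit.gateBits p (some (if b then (p, p) else (k, k)))
        = [true] ++ ((List.range p).map (fun j => decide (j = k) && !b) ++
          (List.range p).map (fun j => decide (j = k) && !b)) := by
      intro b
      have h3 : BoolCircuit.oneHot p (if b then p else k)
          = (List.range p).map (fun j => decide (j = k) && !b) := by
        refine List.map_congr_left fun j hj => ?_
        have := List.mem_range.mp hj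
        cases b
        · simp
        · simp; omega
      rw [← h3]
      cases b <;> rfl
    simp only [h1, h2]
    have h4 : ListCost (coords (Fin m))
        fun y => (List.range p).map (fun j => decide (j = k) && !y ⟨i, hi⟩) := by
      refine ListCost.map _ _ fun j _ => ?_
      by_cases hj : j = k
      · simpa [hj] using (GateCost.of_mem (s := 0) (A := coords (Fin m)) ⟨⟨i, hi⟩, rfl⟩).not
      · simpa [hj] using GateCost.const_false
    exact (ListCost.const _).append (h4.append h4)
  · have h1 : ∀ y : Fin m → Bool,
        (((p, p) :: List.ofFn fun j => if y j then (p, p) else (k, k)) ++ gs)[i + 1]?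
          = gs[i - m]? := by
      intro y
      rw [List.getElem?_append_right (by simp; omega)]
      simp
    simp only [h1]
    exact ListCost.const _

/-! ### Hiding a superspace behind a one-way function -/

/-- The test "`L v = 0`, or `L v` consists of a preimage of `y` under `F` followed by zeros". -/
def pointTest {k lam c m : ℕ} (L : Vec k →ₗ[ZMod 2] (Fin lam ⊕ Fin c → ZMod 2))
    (F : (Fin lam → Bool) → (Fin m → Bool)) (y : Fin m → Bool) (v : Fin k → Bool) : Bool :=
  decide (∀ i : Fin c, L (toVec v) (.inr i) = 0) &&
    (decide (∀ i : Fin lam, L (toVec v) (.inl i) = 0) ||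
      decide (∀ j, F (fun i => bitOf (L (toVec v) (.inl i))) j = y j))

theorem pointTest_eq_true {k lam c m : ℕ} (L : Vec k →ₗ[ZMod 2] (Fin lam ⊕ Fin c → ZMod 2))
    {F : (Fin lam → Bool) → (Fin m → Bool)} (hF : Function.Injective F) (z : Fin lam → Bool)
    (v : Fin k → Bool) :
    pointTest L F (F z) v = true ↔
      L (toVec v) = 0 ∨ L (toVec v) = Sum.elim (toVec z) 0 := by
  have h1 : (∀ j, F (fun i => bitOf (L (toVec v) (.inl i))) j = F z j) ↔
      ∀ i, L (toVec v) (.inl i) = toVec z i := by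
    rw [← funext_iff, hF.eq_iff, funext_iff]
    refine forall_congr' fun i => ?_
    simp only [bitOf, toVec]
    generalize L (toVec v) (.inl i) = a
    generalize z i = b
    revert a b; decide
  simp only [pointTest, Bool.and_eq_true, Bool.or_eq_true, decide_eq_true_eq, h1, funext_iff,
    Sum.forall, Pi.zero_apply, Sum.elim_inl, Sum.elim_inr]
  tauto

/-- A bound for the number of gates that carry out `pointTest`. -/
def pointTestCost (k lam c m d : ℕ) : ℕ :=
  (1 + c * (9 * k + 3)) + ((1 + lam * (9 * k + 3)) + (lam * (9 * k) + d + (1 + m * 12)) + 3) + 2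

theorem pointTest_cost {k lam c m : ℕ} (L : Vec k →ₗ[ZMod 2] (Fin lam ⊕ Fin c → ZMod 2))
    (D : BoolCircuit lam m) {X : Type*} {A : Set (X → Bool)} (φ : X → Fin k → Bool)
    (hφ : ∀ i, (fun x => φ x i) ∈ A) (ψ : X → Fin m → Bool) (hψ : ∀ i, (fun x => ψ x i) ∈ A) :
    GateCost A (pointTestCost k lam c m D.gates.length)
      {fun x => pointTest L D.eval (ψ x) (φ x)} := by
  have h1 := GateCost.linear_eq_zero (fun i : Fin c => LinearMap.proj (Sum.inr i) ∘ₗ L) φ hφ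
  have h2 := GateCost.linear_eq_zero (fun i : Fin lam => LinearMap.proj (Sum.inl i) ∘ₗ L) φ hφ
  have h3 : GateCost A (lam * (9 * k))
      (Set.range fun (i : Fin lam) x => bitOf (L (toVec (φ x)) (.inl i))) := by
    have := GateCost.range fun i : Fin lam =>
      GateCost.linear (LinearMap.proj (Sum.inl i) ∘ₗ L) φ hφ
    simpa using this
  have h4 := GateCost.comp (φ := fun x i => bitOf (L (toVec (φ x)) (.inl i))) h3 D.gateCost
  have h5 : GateCost A (lam * (9 * k) + D.gates.length + (1 + m * 12))
      {fun x => decide (∀ j, D.eval (fun i => bitOf (L (toVec (φ x)) (.inl i))) j = ψ x j)} := by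
    refine (h4.trans_union (GateCost.mono (B := {fun x => decide
      (∀ j, D.eval (fun i => bitOf (L (toVec (φ x)) (.inl i))) j = ψ x j)}) ?_ subset_rfl le_rfl
        subset_rfl)).mono subset_rfl le_rfl Set.subset_union_right
    have h6 := GateCost.forall_mem (Finset.univ : Finset (Fin m))
      (fun j x => !Bool.xor (D.eval (fun i => bitOf (L (toVec (φ x)) (.inl i))) j) (ψ x j))
      fun j _ => (GateCost.xor (s := 0) (s' := 0)
        (A := A ∪ Set.range fun j x => D.eval (fun i => bitOf (L (toVec (φ x)) (.inl i))) j)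
        (GateCost.of_mem (Or.inr ⟨j, rfl⟩)) (GateCost.of_mem (Or.inl (hψ j)))).not
    simpa using h6
  exact h1.and (h2.or h5)

/-- `pointTest` is computed by a circuit of controlled size whose description is easy to compute
from the string `y`. -/
theorem exists_pointTest_circuit {k lam c m p : ℕ}
    (L : Vec k →ₗ[ZMod 2] (Fin lam ⊕ Fin c → ZMod 2)) (D : BoolCircuit lam m)
    (hp : k + (1 + m + pointTestCost k lam c m D.gates.length) + 1 ≤ p) :
    ∃ C : (Fin m → Bool) → BoolCircuit k 1, (∀ y, (C y).size ≤ p) ∧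
      (∀ y v, (C y).eval v 0 = pointTest L D.eval y v) ∧
      ListCost (coords (Fin m)) fun y => (C y).desc p := by
  have h := pointTest_cost L D (A := coords (Fin (k + 1 + m)))
    (fun x i => x (Fin.castAdd m (Fin.castAdd 1 i))) (fun i => ⟨_, rfl⟩)
    (fun x j => x (Fin.natAdd (k + 1) j)) (fun j => ⟨_, rfl⟩)
  obtain ⟨gs, out, hgs, hout⟩ := GateCost.nandComputable (Equiv.refl _)
    (F := fun (_ : Unit) x => pointTest L D.eval (fun j => x (Fin.natAdd (k + 1) j))
      (fun i => x (Fin.castAdd m (Fin.castAdd 1 i))))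
    (h.mono subset_rfl le_rfl (by rintro _ ⟨_, rfl⟩; rfl))
  refine ⟨hardwire k p gs (out ()), fun y => ?_, fun y v => ?_, hardwire_desc k p gs _⟩
  · simp only [BoolCircuit.size, hardwire, List.length_append, List.length_cons, List.length_ofFn]
    omega
  · rw [hardwire_eval _ _ _ (by omega)]
    simpa using hout (Fin.append (Fin.append v fun _ : Fin 1 => true) y) ()

/-! ### Streaming elimination over `ℤ₂` -/

/-- Indicator of the first vector of the family `b` that is not orthogonal to `w`. -/
def isPivot {n : ℕ} (b : Fin n → Vec n) (w : Vec n) (j : Fin n) : Bool :=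
  bitOf (w ⬝ᵥ b j) && decide (∀ i ∈ Finset.Iio j, (!bitOf (w ⬝ᵥ b i)) = true)

/-- The first vector of the family `b` that is not orthogonal to `w`, or zero if there is none. -/
def pivot {n : ℕ} (b : Fin n → Vec n) (w : Vec n) : Vec n :=
  ∑ j, if isPivot b w j then b j else 0

/-- One step of the elimination: the pivot is added to the vectors that are not orthogonal to `w`.
The pivot itself becomes zero. -/
def elimStep {n : ℕ} (b : Fin n → Vec n) (w : Vec n) : Fin n → Vec n :=
  fun j => b j + (w ⬝ᵥ b j) • pivot b w

/-- The vectors that remain from the standard basis after eliminating the vectors of a list. -/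
def elim {n : ℕ} (ws : List (Vec n)) : Fin n → Vec n :=
  ws.foldl elimStep fun j => Pi.single j 1

theorem elim_append_singleton {n : ℕ} (ws : List (Vec n)) (w : Vec n) :
    elim (ws ++ [w]) = elimStep (elim ws) w := by
  simp [elim]

theorem zmod_two_ne_zero_iff (a : ZMod 2) : a ≠ 0 ↔ a = 1 := by
  revert a; decide

theorem pivot_cases {n : ℕ} (b : Fin n → Vec n) (w : Vec n) :
    (∀ j, w ⬝ᵥ b j = 0) ∨ ∃ p, w ⬝ᵥ b p = 1 ∧ pivot b w = b p := by
  by_cases h : ∀ j, w ⬝ᵥ b j = 0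
  · exact Or.inl h
  right
  push Not at h
  have hne : (Finset.univ.filter fun j => w ⬝ᵥ b j ≠ 0).Nonempty := by
    obtain ⟨j, hj⟩ := h
    exact ⟨j, by simpa using hj⟩
  set p := Finset.min' _ hne with hp
  have hp1 : w ⬝ᵥ b p ≠ 0 := by
    have := Finset.min'_mem _ hne
    simpa using this
  have hp2 : ∀ i < p, w ⬝ᵥ b i = 0 := by
    intro i hi
    by_contra hc
    exact absurd (Finset.min'_le _ i (by simpa using hc)) (not_le.mpr hi)
  have hbit : ∀ a : ZMod 2, bitOf a = true ↔ a = 1 := by decide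
  have hbit' : ∀ a : ZMod 2, (!bitOf a) = true ↔ a = 0 := by decide
  refine ⟨p, (zmod_two_ne_zero_iff _).mp hp1, ?_⟩
  rw [pivot, Finset.sum_eq_single p]
  · rw [if_pos]
    simp only [isPivot, Bool.and_eq_true, decide_eq_true_eq, hbit, hbit', Finset.mem_Iio]
    exact ⟨(zmod_two_ne_zero_iff _).mp hp1, hp2⟩
  · intro j _ hj
    rw [if_neg]
    simp only [isPivot, Bool.and_eq_true, decide_eq_true_eq, hbit, hbit', Finset.mem_Iio]
    rintro ⟨h1, h2⟩
    rcases lt_or_gt_of_ne hj with h | h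
    · rw [hp2 j h] at h1
      exact absurd h1 (by decide)
    · exact hp1 (h2 p h)
  · simp

/-- The family stays in reduced echelon form and spans the orthogonal complement of the vectors
eliminated so far. -/
theorem elim_invariant {n : ℕ} (ws : List (Vec n)) :
    (∀ j, ∀ w ∈ ws, w ⬝ᵥ elim ws j = 0) ∧
    (∀ v, (∀ w ∈ ws, w ⬝ᵥ v = 0) → v = ∑ j, v j • elim ws j) ∧
    (∀ i j, elim ws j ≠ 0 → elim ws i j = if i = j then 1 else 0) := by
  induction ws using List.reverseRecOn with
  | nil =>
    refine ⟨by simp, fun v _ => ?_, fun i j _ => ?_⟩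
    · simpa [elim] using pi_eq_sum_univ' v
    · simp [elim, Pi.single_apply, eq_comm]
  | append_singleton ws w ih =>
    obtain ⟨h1, h2, h3⟩ := ih
    rw [elim_append_singleton]
    set b := elim ws
    rcases pivot_cases b w with h | ⟨p, hp, hpiv⟩
    · have hs : elimStep b w = b := by
        funext j
        simp [elimStep, h]
      rw [hs]
      refine ⟨fun j w' hw' => ?_, fun v hv => h2 v fun w' hw' => hv w' (by simp [hw']), h3⟩
      rcases List.mem_append.mp hw' with hw' | hw'
      · exact h1 j w' hw'
      · rw [List.mem_singleton.mp hw']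
        exact h j
    · have hs : ∀ j, elimStep b w j = b j + (w ⬝ᵥ b j) • b p := by
        intro j
        simp [elimStep, hpiv]
      have hbp : b p ≠ 0 := by
        intro h0
        rw [h0] at hp
        simp at hp
      refine ⟨fun j w' hw' => ?_, fun v hv => ?_, fun i j hj => ?_⟩
      · rw [hs, dotProduct_add, dotProduct_smul]
        rcases List.mem_append.mp hw' with hw' | hw'
        · simp [h1 _ w' hw']
        · rw [List.mem_singleton.mp hw', hp, smul_eq_mul, mul_one]
          exact CharTwo.add_self_eq_zero _
      · have hv1 := h2 v fun w' hw' => hv w' (by simp [hw'])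
        have hv2 : w ⬝ᵥ v = 0 := hv w (by simp)
        have hv3 : ∑ j, v j * (w ⬝ᵥ b j) = 0 := by
          conv_lhs at hv2 => rw [hv1]
          simpa [dotProduct_sum, dotProduct_smul] using hv2
        simp only [hs, smul_add, Finset.sum_add_distrib, smul_smul, ← Finset.sum_smul, hv3,
          zero_smul, add_zero]
        exact hv1
      · have hbj : b j ≠ 0 := by
          intro h0
          apply hj
          rw [hs, h0]
          simp
        have hjp : p ≠ j := by
          rintro rfl
          apply hj
          rw [hs, hp, one_smul]
          exact funext fun _ => CharTwo.add_self_eq_zero _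
        rw [hs, Pi.add_apply, Pi.smul_apply, h3 i j hbj, h3 p j hbj, if_neg hjp]
        simp

/-- If exactly one nonzero vector is orthogonal to all vectors of a list, elimination finds it. -/
theorem sum_elim_eq {n : ℕ} (ws : List (Vec n)) (z : Vec n) (hz : z ≠ 0)
    (h : ∀ v, (∀ w ∈ ws, w ⬝ᵥ v = 0) ↔ v = 0 ∨ v = z) : ∑ j, elim ws j = z := by
  obtain ⟨h1, h2, h3⟩ := elim_invariant ws
  have hb : ∀ j, elim ws j = 0 ∨ elim ws j = z := fun j => (h _).mp (h1 j)
  have hex : ∃ p, elim ws p = z := by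
    by_contra hc
    push Not at hc
    have hb0 : ∀ j, elim ws j = 0 := fun j => (hb j).resolve_right (hc j)
    apply hz
    rw [h2 z ((h z).mpr (Or.inr rfl))]
    simp [hb0]
  obtain ⟨p, hp⟩ := hex
  rw [Finset.sum_eq_single p, hp]
  · intro j _ hj
    refine (hb j).resolve_right fun hjz => ?_
    have h4 := h3 j p (by rw [hp]; exact hz)
    have h5 := h3 p p (by rw [hp]; exact hz)
    rw [hjz, if_neg hj] at h4
    rw [hp, if_pos rfl, h4] at h5
    exact absurd h5 (by decide)
  · simp

/-! ### The cost of elimination -/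

section Cost

variable {X : Type*} {A : Set (X → Bool)}

/-- The wires that carry a family of vectors. -/
def vecBits {n : ℕ} (b : X → Fin n → Vec n) : Set (X → Bool) :=
  Set.range fun (p : Fin n × Fin n) x => bitOf (b x p.1 p.2)

theorem GateCost.elimStep {n : ℕ} (b : X → Fin n → Vec n) (w : X → Vec n)
    (hb : vecBits b ⊆ A) (hw : ∀ i, (fun x => bitOf (w x i)) ∈ A) :
    GateCost A (36 * n ^ 2 + 3 * n) (vecBits fun x => DualSubspace.elimStep (b x) (w x)) := by
  have hb' : ∀ j i, (fun x => bitOf (b x j i)) ∈ A := fun j i => hb ⟨(j, i), rfl⟩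
  -- the products `w ⬝ᵥ b j`
  set c : Fin n → X → Bool := fun j x => bitOf (w x ⬝ᵥ b x j) with hc
  have h1 : GateCost A (n * (11 * n)) (Set.range c) := by
    have := GateCost.range (A := A) (s := 11 * n) (p := c) fun j => by
      refine (GateCost.sum (s := 2) Finset.univ (fun i x => w x i * b x j i) fun i _ => ?_).of_le
        (by simp [mul_comm])
      simp only [bitOf_mul]
      exact (GateCost.of_mem (s := 0) (hw i)).and (GateCost.of_mem (s := 0) (hb' j i))
    simpa using this
  -- the pivot indicators
  set d : Fin n → X → Bool := fun j x => isPivot (b x) (w x) j with hd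
  have h2 : GateCost (A ∪ Set.range c) (n * (3 * n + 3)) (Set.range d) := by
    have := GateCost.range (A := A ∪ Set.range c) (s := 3 * n + 3) (p := d) fun j => by
      have hcj : ∀ j, GateCost (A ∪ Set.range c) 0 {c j} := fun j =>
        GateCost.of_mem (Or.inr ⟨j, rfl⟩)
      refine ((hcj j).and (GateCost.forall_mem (Finset.Iio j) (fun i x => !c i x)
        fun i _ => (hcj i).not)).mono subset_rfl ?_ (Set.singleton_subset_singleton.mpr
          (funext fun x => by simp [hd, isPivot, hc]))
      have := (Finset.card_le_univ (Finset.Iio j)).trans_eq (Fintype.card_fin n)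
      omega
    simpa using this
  have h12 := h1.trans_union h2
  -- the pivot
  set e : Fin n → X → Bool := fun i x => bitOf (pivot (b x) (w x) i) with he
  have h3 : GateCost (A ∪ (Set.range c ∪ Set.range d)) (n * (11 * n)) (Set.range e) := by
    have := GateCost.range (A := A ∪ (Set.range c ∪ Set.range d)) (s := 11 * n) (p := e)
      fun i => by
        have he' : e i = fun x => bitOf (∑ j, if d j x then b x j i else 0) := by
          funext x
          simp only [he, pivot, Finset.sum_apply, hd]
          congr 1
          refine Finset.sum_congr rfl fun j _ => ?_
          split_ifs <;> rfl
        rw [he']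
        refine (GateCost.sum (s := 2) Finset.univ (fun j x => if d j x then b x j i else 0)
          fun j _ => ?_).of_le (by simp [mul_comm])
        have hcomb : (fun x => bitOf (if d j x then b x j i else 0))
            = fun x => d j x && bitOf (b x j i) := by
          funext x
          cases d j x <;> simp [bitOf]
        rw [hcomb]
        exact (GateCost.of_mem (s := 0) (Or.inr (Or.inr ⟨j, rfl⟩))).and
          (GateCost.of_mem (s := 0) (Or.inl (hb' j i)))
    simpa using this
  have h123 := h12.trans_union h3
  have h4 : GateCost (A ∪ (Set.range c ∪ Set.range d ∪ Set.range e)) (n * n * 11)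
      (vecBits fun x => DualSubspace.elimStep (b x) (w x)) := by
    have := GateCost.range (A := A ∪ (Set.range c ∪ Set.range d ∪ Set.range e)) (s := 11)
      (p := fun (p : Fin n × Fin n) x => bitOf (DualSubspace.elimStep (b x) (w x) p.1 p.2))
      fun p => by
        have hcomb : (fun x => bitOf (DualSubspace.elimStep (b x) (w x) p.1 p.2))
            = fun x => Bool.xor (bitOf (b x p.1 p.2)) (c p.1 x && e p.2 x) := by
          funext x
          simp only [DualSubspace.elimStep, Pi.add_apply, Pi.smul_apply, smul_eq_mul, bitOf_add,
            bitOf_mul, hc, he]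
        rw [hcomb]
        exact (GateCost.of_mem (s := 0) (Or.inl (hb' _ _))).xor
          ((GateCost.of_mem (s := 0) (Or.inr (Or.inl (Or.inl ⟨_, rfl⟩)))).and
            (GateCost.of_mem (s := 0) (Or.inr (Or.inr ⟨_, rfl⟩))))
    simpa [vecBits] using this
  exact (h123.trans_union h4).mono subset_rfl (by nlinarith) Set.subset_union_right

/-- The vector with entries `ρ i u` if all `ζ j u` vanish, and zero otherwise. -/
def decode {k n : ℕ} (ζ : Fin k → Vec k →ₗ[ZMod 2] ZMod 2) (ρ : Fin n → Vec k →ₗ[ZMod 2] ZMod 2)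
    (u : Vec k) : Vec n :=
  fun i => if ∀ j, ζ j u = 0 then ρ i u else 0

theorem GateCost.decode {k n : ℕ} (ζ : Fin k → Vec k →ₗ[ZMod 2] ZMod 2)
    (ρ : Fin n → Vec k →ₗ[ZMod 2] ZMod 2) (φ : X → Fin k → Bool) (h : ∀ i, (fun x => φ x i) ∈ A) :
    GateCost A ((1 + k * (9 * k + 3)) + n * (9 * k + 2))
      (Set.range fun i x => bitOf (DualSubspace.decode ζ ρ (toVec (φ x)) i)) := by
  have h1 := GateCost.linear_eq_zero ζ φ h
  have h2 := GateCost.range (ι := Fin n)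
    (A := A ∪ {fun x => decide (∀ j, ζ j (toVec (φ x)) = 0)}) (s := 9 * k + 2)
    (p := fun i x => bitOf (DualSubspace.decode ζ ρ (toVec (φ x)) i)) fun i => by
      have hcomb : (fun x => bitOf (DualSubspace.decode ζ ρ (toVec (φ x)) i)) = fun x =>
          bitOf (ρ i (toVec (φ x))) && decide (∀ j, ζ j (toVec (φ x)) = 0) := by
        funext x
        by_cases hx : ∀ j, ζ j (toVec (φ x)) = 0
        · simp [DualSubspace.decode, hx]
        · simp [DualSubspace.decode, hx, bitOf]
      rw [hcomb]
      exact (GateCost.linear (ρ i) φ fun i => Or.inl (h i)).and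
        (GateCost.of_mem (s := 0) (Or.inr rfl))
  rw [Fintype.card_fin] at h2
  exact (h1.trans_union h2).mono subset_rfl le_rfl Set.subset_union_right

end Cost

/-- The string computed from the outputs `u` of `N` runs: the outputs are decoded to vectors of
`ℤ₂^n`, and the remainder of the elimination of these vectors is summed up. -/
def recover {N k n : ℕ} (ζ : Fin N → Fin k → Vec k →ₗ[ZMod 2] ZMod 2)
    (ρ : Fin N → Fin n → Vec k →ₗ[ZMod 2] ZMod 2) (u : Fin N → Fin k → Bool) : Fin n → Bool :=
  fun i => bitOf ((∑ j, elim ((List.finRange N).map fun l => decode (ζ l) (ρ l) (toVec (u l))) j) i)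

/-- The cost of one step of `recover`. -/
def recoverStepCost (k n : ℕ) : ℕ :=
  ((1 + k * (9 * k + 3)) + n * (9 * k + 2)) + (36 * n ^ 2 + 3 * n)

theorem nandComputable_recover {N k n : ℕ} (ζ : Fin N → Fin k → Vec k →ₗ[ZMod 2] ZMod 2)
    (ρ : Fin N → Fin n → Vec k →ₗ[ZMod 2] ZMod 2) :
    NandComputable finProdFinEquiv (n * n + N * recoverStepCost k n + n * (n * 9))
      (fun u : Fin N × Fin k → Bool => recover ζ ρ (fun i j => u (i, j))) := by
  let W : (Fin N × Fin k → Bool) → Fin N → Vec n := fun u l =>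
    decode (ζ l) (ρ l) (toVec fun j => u (l, j))
  have key : ∀ L : List (Fin N), GateCost (coords (Fin N × Fin k))
      (n * n + L.length * recoverStepCost k n)
      (vecBits fun u => elim (L.map (W u))) := by
    intro L
    induction L using List.reverseRecOn with
    | nil =>
      have := GateCost.range (A := coords (Fin N × Fin k)) (s := 1)
        (p := fun (p : Fin n × Fin n) (_ : Fin N × Fin k → Bool) =>
          bitOf ((Pi.single p.1 1 : Vec n) p.2)) fun p => GateCost.const _
      simpa [vecBits, elim] using this
    | append_singleton L l ih =>
      have h1 := GateCost.decode (A := coords (Fin N × Fin k)) (ζ l) (ρ l)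
        (fun u j => u (l, j)) fun j => ⟨_, rfl⟩
      have h2 := ih.trans_union (h1.mono Set.subset_union_left le_rfl subset_rfl)
      have h3 := h2.trans_union (GateCost.elimStep (fun u => elim (L.map (W u))) (fun u => W u l)
        (fun f hf => Or.inr (Or.inl hf)) (fun i => Or.inr (Or.inr ⟨i, rfl⟩)))
      have h4 : (fun u => elim ((L ++ [l]).map (W u)))
          = fun u => elimStep (elim (L.map (W u))) (W u l) := by
        funext u
        rw [List.map_append, List.map_singleton, elim_append_singleton]
      rw [h4]
      refine h3.mono subset_rfl (le_of_eq ?_) Set.subset_union_right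
      simp only [List.length_append, List.length_singleton, recoverStepCost]
      ring
  have h1 := key (List.finRange N)
  rw [List.length_finRange] at h1
  have h2 := GateCost.range (ι := Fin n) (s := n * 9)
    (A := vecBits fun u => elim ((List.finRange N).map (W u)))
    (p := fun i u => recover ζ ρ (fun i j => u (i, j)) i) fun i => by
      have := GateCost.sum (s := 0) (A := vecBits fun u => elim ((List.finRange N).map (W u)))
        (Finset.univ : Finset (Fin n)) (fun j u => elim ((List.finRange N).map (W u)) j i)
        fun j _ => GateCost.of_mem ⟨(j, i), rfl⟩
      have h3 : (fun u : Fin N × Fin k → Bool => recover ζ ρ (fun i j => u (i, j)) i)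
          = fun u => bitOf (∑ j, elim ((List.finRange N).map (W u)) j i) := by
        funext u
        simp only [recover, Finset.sum_apply, W]
      rw [h3]
      simpa using this
  rw [Fintype.card_fin] at h2
  exact (h1.trans h2).nandComputable _

/-! ### Random surjections and random superspaces -/

/-- The surjective linear maps from `ℤ₂^k` to `ℤ₂^ι` that vanish on `S`. -/
noncomputable def surjections {k : ℕ} (S : Submodule (ZMod 2) (Vec k)) (ι : Type) [Fintype ι] :
    Finset (Vec k →ₗ[ZMod 2] (ι → ZMod 2)) :=
  have : Finite (Vec k →ₗ[ZMod 2] (ι → ZMod 2)) := DFunLike.finite _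
  (Set.toFinite {L : Vec k →ₗ[ZMod 2] (ι → ZMod 2) |
    Function.Surjective L ∧ S ≤ LinearMap.ker L}).toFinset

theorem mem_surjections {k : ℕ} {S : Submodule (ZMod 2) (Vec k)} {ι : Type} [Fintype ι]
    {L : Vec k →ₗ[ZMod 2] (ι → ZMod 2)} :
    L ∈ surjections S ι ↔ Function.Surjective L ∧ S ≤ LinearMap.ker L := by
  simp [surjections]

theorem mem_superspaces {k : ℕ} {S T : Submodule (ZMod 2) (Vec k)} {d : ℕ} :
    T ∈ superspaces S d ↔ S ≤ T ∧ Module.finrank (ZMod 2) T = d := by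
  simp [superspaces]

theorem surjections_nonempty {k : ℕ} (S : Submodule (ZMod 2) (Vec k)) (ι : Type) [Fintype ι]
    (h : Module.finrank (ZMod 2) S + Fintype.card ι ≤ k) : (surjections S ι).Nonempty := by
  have h1 : Module.finrank (ZMod 2) (Vec k ⧸ S) + Module.finrank (ZMod 2) S = k := by
    rw [Submodule.finrank_quotient_add_finrank]; simp
  let B := Module.finBasis (ZMod 2) (Vec k ⧸ S)
  have hcard : Fintype.card ι ≤ Fintype.card (Fin (Module.finrank (ZMod 2) (Vec k ⧸ S))) := by
    rw [Fintype.card_fin]; omega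
  obtain ⟨j⟩ := Function.Embedding.nonempty_of_card_le hcard
  refine ⟨LinearMap.funLeft (ZMod 2) (ZMod 2) j ∘ₗ (B.equivFun : _ →ₗ[ZMod 2] _) ∘ₗ S.mkQ,
    mem_surjections.mpr ⟨?_, ?_⟩⟩
  · exact (LinearMap.funLeft_surjective_of_injective (ZMod 2) (ZMod 2) j j.injective).comp
      (B.equivFun.surjective.comp S.mkQ_surjective)
  · intro x hx
    simp [(Submodule.Quotient.mk_eq_zero S).mpr hx]

theorem comap_span_mem_superspaces {k : ℕ} {S : Submodule (ZMod 2) (Vec k)} {ι : Type} [Fintype ι]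
    {L : Vec k →ₗ[ZMod 2] (ι → ZMod 2)} (hL : L ∈ surjections S ι) {a : ι → ZMod 2} (ha : a ≠ 0)
    {d : ℕ} (hd : d + Fintype.card ι = k + 1) :
    (Submodule.span (ZMod 2) {a}).comap L ∈ superspaces S d := by
  obtain ⟨h1, h2⟩ := mem_surjections.mp hL
  rw [mem_superspaces]
  have hker : LinearMap.ker L ≤ (Submodule.span (ZMod 2) {a}).comap L := by
    intro x hx
    rw [Submodule.mem_comap, LinearMap.mem_ker.mp hx]
    exact Submodule.zero_mem _
  refine ⟨h2.trans hker, ?_⟩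
  set T := (Submodule.span (ZMod 2) {a}).comap L
  have hrk := LinearMap.finrank_range_add_finrank_ker L
  rw [LinearMap.range_eq_top.mpr h1, finrank_top] at hrk
  have hrk2 := LinearMap.finrank_range_add_finrank_ker (L.domRestrict T)
  have hr : LinearMap.range (L.domRestrict T) = Submodule.span (ZMod 2) {a} := by
    rw [LinearMap.range_domRestrict, Submodule.map_comap_eq, LinearMap.range_eq_top.mpr h1,
      top_inf_eq]
  have hk : Module.finrank (ZMod 2) (LinearMap.ker (L.domRestrict T))
      = Module.finrank (ZMod 2) (LinearMap.ker L) := by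
    rw [LinearMap.ker_domRestrict]
    exact (Submodule.submoduleOfEquivOfLe hker).finrank_eq
  rw [hr, hk, finrank_span_singleton ha] at hrk2
  simp only [Module.finrank_fintype_fun_eq_card, Fintype.card_fin] at hrk
  omega

/-- The automorphisms that fix `S` pointwise act transitively on the superspaces of `S` of a given
dimension. -/
theorem exists_linearEquiv_map_superspace {K V : Type*} [Field K] [AddCommGroup V] [Module K V]
    [FiniteDimensional K V] {S T T' : Submodule K V} (h : S ≤ T) (h' : S ≤ T')
    (hd : Module.finrank K T = Module.finrank K T') :
    ∃ g : V ≃ₗ[K] V, (∀ x ∈ S, g x = x) ∧ T.map (g : V →ₗ[K] V) = T' := by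
  obtain ⟨A, hA⟩ := Submodule.exists_isCompl (S.submoduleOf T)
  obtain ⟨A', hA'⟩ := Submodule.exists_isCompl (S.submoduleOf T')
  let e₁ : S.submoduleOf T ≃ₗ[K] S.submoduleOf T' :=
    (Submodule.submoduleOfEquivOfLe h).trans (Submodule.submoduleOfEquivOfLe h').symm
  have h1 := Submodule.finrank_add_eq_of_isCompl hA
  have h2 := Submodule.finrank_add_eq_of_isCompl hA'
  have h3 := e₁.finrank_eq
  let e₂ : A ≃ₗ[K] A' := LinearEquiv.ofFinrankEq _ _ (by omega)
  let f : T ≃ₗ[K] T' := (Submodule.prodEquivOfIsCompl _ _ hA).symm ≪≫ₗ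
    (LinearEquiv.prodCongr e₁ e₂) ≪≫ₗ Submodule.prodEquivOfIsCompl _ _ hA'
  obtain ⟨g, hg⟩ := Submodule.exists_linearEquiv_restrict_eq f
  refine ⟨g, fun x hx => ?_, ?_⟩
  · rw [← hg ⟨x, h hx⟩]
    have hx' : (Submodule.prodEquivOfIsCompl _ _ hA).symm ⟨x, h hx⟩
        = (⟨⟨x, h hx⟩, hx⟩, 0) := by
      rw [LinearEquiv.symm_apply_eq]
      simp
    simp only [f, LinearEquiv.trans_apply, hx']
    simp [e₁, Submodule.submoduleOfEquivOfLe]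
  · ext y
    constructor
    · rintro ⟨x, hx, rfl⟩
      have := hg ⟨x, hx⟩
      simp only [LinearEquiv.coe_coe]
      rw [← this]
      exact (f ⟨x, hx⟩).2
    · intro hy
      refine ⟨(f.symm ⟨y, hy⟩ : T), (f.symm ⟨y, hy⟩).2, ?_⟩
      simp only [LinearEquiv.coe_coe]
      rw [← hg, LinearEquiv.apply_symm_apply]

theorem expect_comp_of_card_fiber {α β : Type*} [DecidableEq β] {P : Finset α} {Q : Finset β}
    (π : α → β) (hπ : ∀ a ∈ P, π a ∈ Q) (hP : P.Nonempty) (n : ℕ)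
    (hn : ∀ b ∈ Q, (P.filter fun a => π a = b).card = n) (g : β → ℝ) :
    𝔼 a ∈ P, g (π a) = 𝔼 b ∈ Q, g b := by
  have h1 : P.card = Q.card * n := by
    rw [Finset.card_eq_sum_card_fiberwise hπ, Finset.sum_congr rfl hn, Finset.sum_const,
      smul_eq_mul]
  have h2 : ∑ a ∈ P, g (π a) = n * ∑ b ∈ Q, g b := by
    rw [← Finset.sum_fiberwise_of_maps_to hπ, Finset.mul_sum]
    refine Finset.sum_congr rfl fun b hb => ?_
    rw [Finset.sum_congr rfl (g := fun _ => g b) (by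
      intro a ha
      rw [(Finset.mem_filter.mp ha).2]), Finset.sum_const, hn b hb, nsmul_eq_mul]
  have hn0 : (n : ℝ) ≠ 0 := by
    have := hP.card_pos
    rintro h0
    rw [Nat.cast_eq_zero.mp h0] at h1
    omega
  rw [Finset.expect_eq_sum_div_card, Finset.expect_eq_sum_div_card, h1, h2, Nat.cast_mul,
    mul_comm (Q.card : ℝ), mul_div_mul_left _ _ hn0]

/-- The preimage of a fixed line under a random surjection is a uniformly random superspace, since
the automorphisms of `ℤ₂^k` that fix `S` act transitively on the superspaces of a given
dimension. -/
theorem expect_surjections {k : ℕ} (S : Submodule (ZMod 2) (Vec k)) (ι : Type) [Fintype ι]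
    (h : Module.finrank (ZMod 2) S + Fintype.card ι ≤ k) {a : ι → ZMod 2} (ha : a ≠ 0)
    {d : ℕ} (hd : d + Fintype.card ι = k + 1) (g : Submodule (ZMod 2) (Vec k) → ℝ) :
    𝔼 L ∈ surjections S ι, g ((Submodule.span (ZMod 2) {a}).comap L)
      = 𝔼 T ∈ superspaces S d, g T := by
  classical
  obtain ⟨L₀, hL₀⟩ := surjections_nonempty S ι h
  have hT₀ := comap_span_mem_superspaces hL₀ ha hd
  refine expect_comp_of_card_fiber (fun L => (Submodule.span (ZMod 2) {a}).comap L)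
    (fun L hL => comap_span_mem_superspaces hL ha hd) ⟨L₀, hL₀⟩
    ((surjections S ι).filter fun L => (Submodule.span (ZMod 2) {a}).comap L
      = (Submodule.span (ZMod 2) {a}).comap L₀).card (fun T hT => ?_) g
  rw [mem_superspaces] at hT hT₀
  obtain ⟨e, he1, he2⟩ := exists_linearEquiv_map_superspace hT.1 hT₀.1 (hT.2.trans hT₀.2.symm)
  have key : ∀ (e : Vec k ≃ₗ[ZMod 2] Vec k) (T T' : Submodule (ZMod 2) (Vec k)),
      (∀ x ∈ S, e x = x) → T.map (e : Vec k →ₗ[ZMod 2] Vec k) = T' →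
      ∀ L ∈ (surjections S ι).filter fun L => (Submodule.span (ZMod 2) {a}).comap L = T,
        L ∘ₗ (e.symm : Vec k →ₗ[ZMod 2] Vec k) ∈
          (surjections S ι).filter fun L => (Submodule.span (ZMod 2) {a}).comap L = T' := by
    intro e T T' h1 h2 L hL
    rw [Finset.mem_filter, mem_surjections] at hL ⊢
    obtain ⟨⟨hL1, hL2⟩, hL3⟩ := hL
    refine ⟨⟨?_, fun x hx => ?_⟩, ?_⟩
    · rw [LinearMap.coe_comp]
      exact hL1.comp e.symm.surjective
    · have : e.symm x = x := by rw [LinearEquiv.symm_apply_eq, h1 x hx]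
      rw [LinearMap.mem_ker, LinearMap.comp_apply, LinearEquiv.coe_coe, this]
      exact hL2 hx
    · rw [Submodule.comap_comp, hL3, ← h2, Submodule.map_equiv_eq_comap_symm]
  refine Finset.card_nbij' (fun L => L ∘ₗ (e.symm : Vec k →ₗ[ZMod 2] Vec k))
    (fun L => L ∘ₗ (e : Vec k →ₗ[ZMod 2] Vec k)) (key e _ _ he1 he2) ?_ ?_ ?_
  · have h1 : ∀ x ∈ S, e.symm x = x := fun x hx => by
      rw [LinearEquiv.symm_apply_eq, he1 x hx]
    have h2 : ((Submodule.span (ZMod 2) {a}).comap L₀).map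
        (e.symm : Vec k →ₗ[ZMod 2] Vec k) = T := by
      rw [← he2, ← Submodule.map_comp]
      simp
    exact key e.symm _ _ h1 h2
  · intro L _
    ext; simp
  · intro L _
    ext; simp

/-! ### Outputs that reveal a functional -/

/-- The vector `u` is orthogonal to the kernel of `L`, and the functional on `ℤ₂^ι` that it induces
takes the value one at `b`. -/
def Hits {k : ℕ} {ι : Type} (L : Vec k →ₗ[ZMod 2] (ι → ZMod 2)) (b : ι → ZMod 2) (u : Vec k) :
    Prop :=
  (∀ v, L v = 0 → v ⬝ᵥ u = 0) ∧ ∀ v, L v = b → v ⬝ᵥ u = 1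

theorem exists_functional {k : ℕ} {ι : Type} {L : Vec k →ₗ[ZMod 2] (ι → ZMod 2)}
    (hL : Function.Surjective L) {u : Vec k} (hu : ∀ v, L v = 0 → v ⬝ᵥ u = 0) :
    ∃ ω : (ι → ZMod 2) →ₗ[ZMod 2] ZMod 2, ∀ v, v ⬝ᵥ u = ω (L v) := by
  obtain ⟨R, hR⟩ := L.exists_rightInverse_of_surjective (LinearMap.range_eq_top.mpr hL)
  refine ⟨(dotProductBilin (ZMod 2) (ZMod 2) u) ∘ₗ R, fun v => ?_⟩
  have h1 : L (v - R (L v)) = 0 := by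
    rw [map_sub, sub_eq_zero]
    exact (LinearMap.congr_fun hR (L v)).symm
  have h2 := hu _ h1
  rw [sub_dotProduct, sub_eq_zero] at h2
  rw [h2, dotProduct_comm]
  rfl

/-- Whether a vector hits can be read off linear functionals of that vector. -/
theorem exists_decode_iff_hits {k n c : ℕ} {L : Vec k →ₗ[ZMod 2] (Fin n ⊕ Fin c → ZMod 2)}
    (hL : Function.Surjective L) :
    ∃ (ζ : Fin k → Vec k →ₗ[ZMod 2] ZMod 2) (ρ : Fin n → Vec k →ₗ[ZMod 2] ZMod 2),
      ∀ u b, decode ζ ρ u ⬝ᵥ b = 1 ↔ Hits L (Sum.elim b 0) u := by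
  obtain ⟨R, hR⟩ := L.exists_rightInverse_of_surjective (LinearMap.range_eq_top.mpr hL)
  have hR' : ∀ x, L (R x) = x := LinearMap.congr_fun hR
  refine ⟨fun j => dotProductBilin (ZMod 2) (ZMod 2) (Pi.single j 1 - R (L (Pi.single j 1))),
    fun i => dotProductBilin (ZMod 2) (ZMod 2) (R (Pi.single (.inl i) 1)), fun u b => ?_⟩
  have hvalid : (∀ j, dotProductBilin (ZMod 2) (ZMod 2)
      (Pi.single j 1 - R (L (Pi.single j 1))) u = 0) ↔ ∀ v, L v = 0 → v ⬝ᵥ u = 0 := by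
    constructor
    · intro h
      have h1 : (dotProductBilin (ZMod 2) (ZMod 2)).flip u ∘ₗ (LinearMap.id - R ∘ₗ L) = 0 := by
        refine (Pi.basisFun (ZMod 2) (Fin k)).ext fun j => ?_
        rw [Pi.basisFun_apply]
        exact h j
      intro v hv
      have h2 := LinearMap.congr_fun h1 v
      simp only [LinearMap.comp_apply, LinearMap.sub_apply, hv, map_zero, sub_zero,
        LinearMap.id_apply, LinearMap.zero_apply] at h2
      exact h2
    · intro h j
      exact h _ (by rw [map_sub, hR', sub_self])
  have hb : Sum.elim b 0 = ∑ i, b i • (Pi.single (.inl i) 1 : Fin n ⊕ Fin c → ZMod 2) := by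
    funext x
    rw [Finset.sum_apply]
    rcases x with x | x <;> simp [Pi.single_apply]
  by_cases hv : ∀ v, L v = 0 → v ⬝ᵥ u = 0
  · have h1 : decode (fun j => dotProductBilin (ZMod 2) (ZMod 2)
        (Pi.single j 1 - R (L (Pi.single j 1))))
        (fun i => dotProductBilin (ZMod 2) (ZMod 2) (R (Pi.single (.inl i) 1))) u ⬝ᵥ b
        = R (Sum.elim b 0) ⬝ᵥ u := by
      rw [hb, map_sum, sum_dotProduct]
      simp only [dotProduct, decode, if_pos (hvalid.mpr hv), map_smul, Pi.smul_apply,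
        smul_eq_mul, mul_assoc, ← Finset.mul_sum]
      refine Finset.sum_congr rfl fun i _ => ?_
      rw [mul_comm]
      rfl
    rw [h1]
    obtain ⟨ω, hω⟩ := exists_functional hL hv
    refine ⟨fun h => ⟨hv, fun v hLv => ?_⟩, fun h => h.2 _ (hR' _)⟩
    rw [hω, hLv, ← h, hω, hR']
  · have h1 : ∀ (ρ : Fin n → Vec k →ₗ[ZMod 2] ZMod 2), decode (fun j => dotProductBilin (ZMod 2)
        (ZMod 2) (Pi.single j 1 - R (L (Pi.single j 1)))) ρ u = 0 := by
      intro ρ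
      funext i
      simp only [decode, if_neg (mt hvalid.mp hv), Pi.zero_apply]
    rw [h1, zero_dotProduct]
    exact ⟨fun h => absurd h (by decide), fun h => absurd h.1 hv⟩

theorem Hits.mem_perp_diff {k : ℕ} {S : Submodule (ZMod 2) (Vec k)} {ι : Type} [Fintype ι]
    {L : Vec k →ₗ[ZMod 2] (ι → ZMod 2)} (hL : L ∈ surjections S ι) {a : ι → ZMod 2} {u : Vec k}
    (h : Hits L a u) : u ∈ perp S ∧ u ∉ perp ((Submodule.span (ZMod 2) {a}).comap L) := by
  obtain ⟨h1, h2⟩ := mem_surjections.mp hL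
  refine ⟨fun v hv => h.1 v (h2 hv), fun hu => ?_⟩
  obtain ⟨v, hv⟩ := h1 a
  have h3 : v ⬝ᵥ u = 0 := hu v (by
    rw [Submodule.mem_comap, hv]
    exact Submodule.mem_span_singleton_self a)
  rw [h.2 v hv] at h3
  exact absurd h3 (by decide)

/-- A nonzero functional takes the value one on at least half of an affine hyperplane `b + ker φ`
with `φ b = 1`. -/
theorem card_ker_le_two_mul_card {W : Type*} [AddCommGroup W] [Module (ZMod 2) W] [Fintype W]
    [DecidableEq W] (φ ω : W →ₗ[ZMod 2] ZMod 2) (hω : ω ≠ 0) {b : W} (hb : φ b = 1) :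
    (Finset.univ.filter fun c => φ c = 0).card ≤
      2 * ((Finset.univ.filter fun c => φ c = 0).filter fun c => ω (b + c) = 1).card := by
  set Z := Finset.univ.filter fun c => φ c = 0 with hZ
  by_cases h : ∀ c, φ c = 0 → ω c = 0
  · have hωb : ω b = 1 := by
      refine (zmod_two_ne_zero_iff _).mp fun h0 => hω ?_
      ext w
      have h1 := h (w - φ w • b) (by simp [hb])
      rw [map_sub, map_smul, h0, smul_zero, sub_zero] at h1
      simpa using h1
    have : (Z.filter fun c => ω (b + c) = 1) = Z := by
      refine Finset.filter_true_of_mem fun c hc => ?_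
      rw [map_add, hωb, h c (by simpa [hZ] using hc), add_zero]
    rw [this]
    omega
  · push Not at h
    obtain ⟨c₀, hc₀, hωc₀⟩ := h
    rw [zmod_two_ne_zero_iff] at hωc₀
    have hle : (Z.filter fun c => ¬ ω (b + c) = 1).card ≤
        (Z.filter fun c => ω (b + c) = 1).card := by
      refine Finset.card_le_card_of_injOn (· + c₀) (fun c hc => ?_) (fun x _ y _ hxy => by
        simpa using hxy)
      simp only [hZ, Finset.coe_filter, Finset.mem_filter, Finset.mem_univ, true_and,
        Set.mem_ofPred_eq] at hc ⊢
      refine ⟨by rw [map_add, hc.1, hc₀, add_zero], ?_⟩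
      have h2 : ω (b + c) = 0 := by
        by_contra h0
        exact hc.2 ((zmod_two_ne_zero_iff _).mp h0)
      rw [← add_assoc, map_add, h2, hωc₀, zero_add]
    have := Finset.card_filter_add_card_filter_not (s := Z) (fun c => ω (b + c) = 1)
    omega

/-- If `b` lies outside the line of `a`, then among the surjections for which the preimage of this
line is a given space `T`, at least half make a given nonzero vector of `T^⊥` hit at `b`. The proof
averages over the transvections `x ↦ x + φ x • c` with `φ a = φ c = 0` and `φ b = 1`. -/
theorem sum_perp_le_two_mul_sum_hits {k : ℕ} (S : Submodule (ZMod 2) (Vec k)) {ι : Type}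
    [Fintype ι] {a b : ι → ZMod 2} (hab : b ∉ Submodule.span (ZMod 2) {a}) (u : Vec k)
    (w : Submodule (ZMod 2) (Vec k) → ℝ) (hw : ∀ T, 0 ≤ w T)
    [∀ L : Vec k →ₗ[ZMod 2] (ι → ZMod 2), Decidable (Hits L b u)]
    [∀ T : Submodule (ZMod 2) (Vec k), Decidable (u ∈ perp T ∧ u ≠ 0)] :
    ∑ L ∈ surjections S ι, (if u ∈ perp ((Submodule.span (ZMod 2) {a}).comap L) ∧ u ≠ 0 then
        w ((Submodule.span (ZMod 2) {a}).comap L) else 0) ≤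
      2 * ∑ L ∈ surjections S ι,
        if Hits L b u then w ((Submodule.span (ZMod 2) {a}).comap L) else 0 := by
  classical
  obtain ⟨φ, hφa, hφb⟩ : ∃ φ : (ι → ZMod 2) →ₗ[ZMod 2] ZMod 2, φ a = 0 ∧ φ b = 1 := by
    obtain ⟨φ, h1, h2⟩ := LinearMap.exists_extend_of_notMem
      (0 : Submodule.span (ZMod 2) {a} →ₗ[ZMod 2] ZMod 2) hab 1
    exact ⟨φ, by
      simpa using LinearMap.congr_fun h1 ⟨a, Submodule.mem_span_singleton_self a⟩, h2⟩
  set Z := Finset.univ.filter fun c => φ c = 0 with hZ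
  have hZ0 : (0 : ℝ) < Z.card := by
    have : (0 : ι → ZMod 2) ∈ Z := by simp [hZ]
    exact_mod_cast Finset.card_pos.mpr ⟨_, this⟩
  -- the transvections
  let h : (ι → ZMod 2) → (ι → ZMod 2) →ₗ[ZMod 2] (ι → ZMod 2) := fun c =>
    LinearMap.id + φ.smulRight c
  have hh : ∀ c x, h c x = x + φ x • c := fun c x => rfl
  have hinv : ∀ c ∈ Z, ∀ x, h c (h c x) = x := by
    intro c hc x
    have hc0 : φ c = 0 := by simpa [hZ] using hc
    rw [hh, hh, map_add, map_smul, hc0, smul_zero, add_zero, add_assoc]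
    have : φ x • c + φ x • c = 0 := by
      funext i
      rw [Pi.add_apply]
      exact CharTwo.add_self_eq_zero _
    rw [this, add_zero]
  have hcomp : ∀ c ∈ Z, ∀ L : Vec k →ₗ[ZMod 2] (ι → ZMod 2), h c ∘ₗ (h c ∘ₗ L) = L :=
    fun c hc L => LinearMap.ext fun x => hinv c hc _
  have hmem : ∀ c ∈ Z, ∀ L ∈ surjections S ι, h c ∘ₗ L ∈ surjections S ι := by
    intro c hc L hL
    rw [mem_surjections] at hL ⊢
    refine ⟨?_, fun x hx => ?_⟩
    · rw [LinearMap.coe_comp]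
      exact (Function.Involutive.surjective (hinv c hc)).comp hL.1
    · rw [LinearMap.mem_ker, LinearMap.comp_apply, LinearMap.mem_ker.mp (hL.2 hx), map_zero]
  have hT : ∀ c ∈ Z, ∀ L : Vec k →ₗ[ZMod 2] (ι → ZMod 2),
      (Submodule.span (ZMod 2) {a}).comap (h c ∘ₗ L) = (Submodule.span (ZMod 2) {a}).comap L := by
    intro c hc L
    have h1 : ∀ x ∈ Submodule.span (ZMod 2) {a}, h c x = x := by
      intro x hx
      obtain ⟨r, rfl⟩ := Submodule.mem_span_singleton.mp hx
      rw [hh, map_smul, hφa, smul_zero, zero_smul, add_zero]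
    ext v
    simp only [Submodule.mem_comap, LinearMap.comp_apply]
    constructor
    · intro hv
      have h2 := h1 _ hv
      rw [hinv c hc] at h2
      rwa [h2]
    · intro hv
      rwa [h1 _ hv]
  have hswap : ∀ c ∈ Z, ∑ L ∈ surjections S ι,
        (if Hits L b u then w ((Submodule.span (ZMod 2) {a}).comap L) else 0)
      = ∑ L ∈ surjections S ι, if Hits (h c ∘ₗ L) b u then
          w ((Submodule.span (ZMod 2) {a}).comap L) else 0 := by
    intro c hc
    refine Finset.sum_nbij' (fun L => h c ∘ₗ L) (fun L => h c ∘ₗ L) (hmem c hc) (hmem c hc)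
      (fun L _ => hcomp c hc L) (fun L _ => hcomp c hc L) fun L _ => ?_
    simp only [hcomp c hc, hT c hc]
  -- for each surjection, half of the transvections make `u` hit
  have hcount : ∀ L ∈ surjections S ι, u ∈ perp ((Submodule.span (ZMod 2) {a}).comap L) → u ≠ 0 →
      (Z.card : ℝ) ≤ 2 * (Z.filter fun c => Hits (h c ∘ₗ L) b u).card := by
    intro L hL hu hu0
    have hsurj := (mem_surjections.mp hL).1
    have hker : ∀ v, L v = 0 → v ⬝ᵥ u = 0 := fun v hv => hu v (by
      rw [Submodule.mem_comap, hv]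
      exact Submodule.zero_mem _)
    obtain ⟨ω, hω⟩ := exists_functional hsurj hker
    have hω0 : ω ≠ 0 := by
      rintro rfl
      refine hu0 (dotProduct_eq_zero u fun v => ?_)
      rw [dotProduct_comm, hω]
      rfl
    have hle := card_ker_le_two_mul_card φ ω hω0 hφb
    refine le_trans (b := 2 * (((Z.filter fun c => ω (b + c) = 1).card : ℕ) : ℝ))
      (by exact_mod_cast hle) (mul_le_mul_of_nonneg_left ?_ zero_le_two)
    refine Nat.cast_le.mpr (Finset.card_le_card fun c hc => ?_)
    rw [Finset.mem_filter] at hc ⊢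
    refine ⟨hc.1, fun v hv => hker v ?_, fun v hv => ?_⟩
    · rw [LinearMap.comp_apply] at hv
      rw [← hinv c hc.1 (L v), hv, map_zero]
    · rw [LinearMap.comp_apply] at hv
      rw [hω, ← hinv c hc.1 (L v), hv, hh, hφb, one_smul]
      exact hc.2
  have hmain : (Z.card : ℝ) * ∑ L ∈ surjections S ι,
        (if u ∈ perp ((Submodule.span (ZMod 2) {a}).comap L) ∧ u ≠ 0 then
          w ((Submodule.span (ZMod 2) {a}).comap L) else 0)
      ≤ Z.card * (2 * ∑ L ∈ surjections S ι,
        if Hits L b u then w ((Submodule.span (ZMod 2) {a}).comap L) else 0) := by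
    have h1 : (Z.card : ℝ) * ∑ L ∈ surjections S ι,
        (if Hits L b u then w ((Submodule.span (ZMod 2) {a}).comap L) else 0)
        = ∑ L ∈ surjections S ι, (Z.filter fun c => Hits (h c ∘ₗ L) b u).card *
            w ((Submodule.span (ZMod 2) {a}).comap L) := by
      rw [← nsmul_eq_mul, ← Finset.sum_const, Finset.sum_congr rfl hswap, Finset.sum_comm]
      refine Finset.sum_congr rfl fun L _ => ?_
      rw [← Finset.sum_filter, Finset.sum_const, nsmul_eq_mul]
    rw [mul_left_comm, h1, Finset.mul_sum, Finset.mul_sum]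
    refine Finset.sum_le_sum fun L hL => ?_
    rw [← mul_assoc]
    split_ifs with hu
    · exact mul_le_mul_of_nonneg_right (hcount L hL hu.1 hu.2) (hw _)
    · rw [mul_zero]
      exact mul_nonneg (by positivity) (hw _)
  exact le_of_mul_le_mul_left hmain hZ0

/-! ### Distinguishers -/

/-- A cheap Boolean function of the output of a quantum algorithm can be computed as part of it. -/
theorem QCircuit.exists_postprocess {k s : ℕ} (d : ℕ) (A : QCircuit k) (P : (Fin k → Bool) → Bool)
    (hP : GateCost (coords (Fin k)) s {P}) :
    ∃ B : QCircuit 1, B.size ≤ d + A.size + 2 * s ∧ ∀ x : List Bool, x.length = d →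
      B.prob x (fun b => b 0 = true) = A.prob x (fun u => P u = true) := by
  classical
  have hG : NandComputable (Equiv.refl (Fin d)) 0
      (fun x (p : Fin 1 × Fin d) => (fun (x : Fin d → Bool) (_ : Fin 1) => x) x p.1 p.2) := by
    refine GateCost.nandComputable _ (F := fun (p : Fin 1 × Fin d) x => x p.2)
      (GateCost.of_subset ?_)
    rintro _ ⟨p, rfl⟩
    exact ⟨p.2, rfl⟩
  have hH : NandComputable finProdFinEquiv s
      (fun u : Fin 1 × Fin k → Bool => (fun (u : Fin 1 → Fin k → Bool) (_ : Fin 1) => P (u 0))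
        (fun i j => u (i, j))) := by
    refine GateCost.nandComputable _ (F := fun (_ : Fin 1) (u : Fin 1 × Fin k → Bool) =>
      P fun j => u (0, j)) ((hP.comap fun (u : Fin 1 × Fin k → Bool) j => u (0, j)).mono ?_ le_rfl ?_)
    · rintro _ ⟨_, ⟨j, rfl⟩, rfl⟩
      exact ⟨(0, j), rfl⟩
    · rintro _ ⟨_, rfl⟩
      exact ⟨P, rfl, rfl⟩
  obtain ⟨B, hB, h⟩ := QCircuit.exists_parallel A (fun x _ => x) hG
    (fun u _ => P (u 0)) hH
  refine ⟨B, by omega, fun x hx => ?_⟩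
  subst hx
  have h1 := h x.get fun b => b 0 = true
  rw [List.ofFn_get] at h1
  rw [h1, QCircuit.prob]
  refine Fintype.sum_equiv (Equiv.funUnique (Fin 1) _) _ _ fun r => ?_
  simp

/-- Security of the obfuscation bounds the change in the probability of every event that is cheap to
test on the output of an algorithm. -/
theorem Obfuscator.Secure.abs_probOn_sub_le {iO : Obfuscator} {f : ℕ → ℕ} {ε : ℕ → ℝ}
    (h : iO.Secure f ε) {κ p n l s : ℕ} {C₀ C₁ : BoolCircuit n 1} (hC : C₀.eval = C₁.eval)
    (h₀ : C₀.size ≤ p) (h₁ : C₁.size ≤ p) (A : QCircuit l) (E : (Fin l → Bool) → Prop)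
    (P : (Fin l → Bool) → Bool) (hE : ∀ u, E u ↔ P u = true)
    (hP : GateCost (coords (Fin l)) s {P})
    (hs : descLen (iO.outSize κ p) 1 + A.size + 2 * s ≤ f κ) :
    |iO.probOn κ p C₀ A E - iO.probOn κ p C₁ A E| ≤ ε κ := by
  obtain ⟨B, hB, hB'⟩ := A.exists_postprocess (descLen (iO.outSize κ p) 1) P hP
  have key : ∀ C : BoolCircuit n 1,
      iO.probOn κ p C A E = iO.probOn κ p C B (fun b => b 0 = true) := by
    intro C
    refine Finset.expect_congr rfl fun ρ _ => ?_
    rw [hB' _ (BoolCircuit.length_desc _ _)]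
    exact congrArg _ (funext fun u => propext (hE u))
  rw [key, key]
  exact h κ p n 1 C₀ C₁ hC h₀ h₁ B (hB.trans hs)

/-- A bound for the number of gates that test whether a vector hits. -/
def hitCost (k n : ℕ) : ℕ := ((1 + k * (9 * k + 3)) + n * (9 * k + 2)) + n * 12

theorem exists_hits_cost {k n c : ℕ} {L : Vec k →ₗ[ZMod 2] (Fin n ⊕ Fin c → ZMod 2)}
    (hL : Function.Surjective L) (b : Vec n) :
    ∃ P : (Fin k → Bool) → Bool, (∀ u, Hits L (Sum.elim b 0) (toVec u) ↔ P u = true) ∧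
      GateCost (coords (Fin k)) (hitCost k n) {P} := by
  obtain ⟨ζ, ρ, h⟩ := exists_decode_iff_hits hL
  refine ⟨fun u => bitOf (decode ζ ρ (toVec u) ⬝ᵥ b), fun u => ?_, ?_⟩
  · rw [← h]
    exact decide_eq_true_iff.symm
  · refine (GateCost.decode (A := coords (Fin k)) ζ ρ (fun u => u) fun i => ⟨i, rfl⟩).trans ?_
    refine (GateCost.sum (s := 3) Finset.univ (fun i u => decode ζ ρ (toVec u) i * b i)
      fun i _ => ?_).of_le (by simp)
    simp only [bitOf_mul]
    have hm : (fun u => bitOf (decode ζ ρ (toVec u) i)) ∈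
        Set.range fun i (u : Fin k → Bool) => bitOf (decode ζ ρ (toVec u) i) := ⟨i, rfl⟩
    exact (GateCost.of_mem (s := 0) hm).and (GateCost.const _)

/-! ### The output on obfuscated membership circuits -/

open Classical in
theorem Obfuscator.probOn_eq_sum (iO : Obfuscator) {κ p n l : ℕ} (C : BoolCircuit n 1)
    (A : QCircuit l) (E : (Fin l → Bool) → Prop) :
    iO.probOn κ p C A E = ∑ x : (Fin (iO.coins κ p) → Bool) × (Fin A.wires → Bool),
      if E (fun j => x.2 (A.out j)) then
        ‖A.finalState ((iO.obf κ p C x.1).desc (iO.outSize κ p)) x.2‖ ^ 2 /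
          Fintype.card (Fin (iO.coins κ p) → Bool) else 0 := by
  rw [Obfuscator.probOn, Fintype.expect_eq_sum_div_card, Finset.sum_div, Fintype.sum_prod_type]
  refine Finset.sum_congr rfl fun ρ _ => ?_
  rw [QCircuit.prob, Finset.sum_div]
  refine Finset.sum_congr rfl fun v _ => ?_
  split_ifs <;> simp

theorem Obfuscator.probOn_mono (iO : Obfuscator) {κ p n l : ℕ} (C : BoolCircuit n 1)
    (A : QCircuit l) {E E' : (Fin l → Bool) → Prop} (h : ∀ u, E u → E' u) :
    iO.probOn κ p C A E ≤ iO.probOn κ p C A E' :=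
  Finset.expect_le_expect fun _ _ => A.prob_mono _ h

theorem Obfuscator.probOn_le_one (iO : Obfuscator) {κ p n l : ℕ} (C : BoolCircuit n 1)
    (A : QCircuit l) (E : (Fin l → Bool) → Prop) : iO.probOn κ p C A E ≤ 1 :=
  Finset.expect_le Finset.univ_nonempty fun _ _ => A.prob_le_one _ _

section Experiment

variable (iO : Obfuscator) (CM : (k : ℕ) → Submodule (ZMod 2) (Vec k) → BoolCircuit k 1)
  (κ p : ℕ) {k : ℕ} (S : Submodule (ZMod 2) (Vec k)) {ι : Type} [Fintype ι] (A : QCircuit k)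

/-- If the hidden line is that of `a`, a hit at `a` reveals a vector of `S^⊥` outside `T^⊥`. -/
theorem expect_hits_le (h : Module.finrank (ZMod 2) S + Fintype.card ι ≤ k) {a : ι → ZMod 2}
    (ha : a ≠ 0) {d : ℕ} (hd : d + Fintype.card ι = k + 1) :
    𝔼 L ∈ surjections S ι, iO.probOn κ p (CM k ((Submodule.span (ZMod 2) {a}).comap L)) A
        (fun u => Hits L a (toVec u))
      ≤ superspaceExperiment iO CM κ p S d A (fun T u => u ∈ perp S ∧ u ∉ perp T) := by
  rw [superspaceExperiment, ← expect_surjections S ι h ha hd]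
  exact Finset.expect_le_expect fun L hL => iO.probOn_mono _ A fun u hu => hu.mem_perp_diff hL

/-- A nonzero vector of `T^⊥` hits at every point outside the hidden line with probability at least
one half over the choice of the surjection given `T`. -/
theorem experiment_le_two_mul_expect_hits
    (h : Module.finrank (ZMod 2) S + Fintype.card ι ≤ k) {a b : ι → ZMod 2}
    (ha : a ≠ 0) (hab : b ∉ Submodule.span (ZMod 2) {a}) {d : ℕ}
    (hd : d + Fintype.card ι = k + 1) :
    superspaceExperiment iO CM κ p S d A (fun T u => u ∈ perp T ∧ u ≠ 0) ≤
      2 * 𝔼 L ∈ surjections S ι, iO.probOn κ p (CM k ((Submodule.span (ZMod 2) {a}).comap L)) A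
        (fun u => Hits L b (toVec u)) := by
  classical
  rw [superspaceExperiment, ← expect_surjections S ι h ha hd, Finset.expect_eq_sum_div_card,
    Finset.expect_eq_sum_div_card, ← mul_div_assoc]
  refine div_le_div_of_nonneg_right ?_ (Nat.cast_nonneg _)
  simp only [Obfuscator.probOn_eq_sum]
  rw [Finset.sum_comm, Finset.sum_comm (s := surjections S ι), Finset.mul_sum]
  refine Finset.sum_le_sum fun x _ => ?_
  have := sum_perp_le_two_mul_sum_hits S hab (toVec fun j => x.2 (A.out j)) (fun T =>
    ‖A.finalState ((iO.obf κ p (CM k T) x.1).desc (iO.outSize κ p)) x.2‖ ^ 2 /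
      Fintype.card (Fin (iO.coins κ p) → Bool)) fun T => by positivity
  refine le_of_eq_of_le ?_ (this.trans_eq ?_) <;> congr!

end Experiment

/-! ### Repeated sampling -/

theorem sum_prod_ite_forall {Ω : Type*} [Fintype Ω] {N : ℕ} (μ : Ω → ℝ) (P : Ω → Prop)
    [DecidablePred P] [∀ ω : Fin N → Ω, Decidable (∀ i, P (ω i))] :
    ∑ ω : Fin N → Ω, (if ∀ i, P (ω i) then ∏ i, μ (ω i) else 0)
      = (∑ x, if P x then μ x else 0) ^ N := by
  rw [Fintype.sum_pow]
  refine Finset.sum_congr rfl fun ω _ => ?_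
  rw [Finset.prod_ite_zero]
  simp

open Classical in
/-- Let `N` samples be drawn independently. Then no sample satisfies `P z`, while for every `b ∈ I`
some sample satisfies `P b`, with at least the probability given by the union bound. -/
theorem union_bound {Ω β : Type*} [Fintype Ω] {N : ℕ} (μ : Ω → ℝ) (hμ : ∀ x, 0 ≤ μ x)
    (hμ1 : ∑ x, μ x = 1) (P : β → Ω → Prop) (z : β) (I : Finset β) (G : (Fin N → Ω) → Prop)
    (hG : ∀ ω, (∀ i, ¬ P z (ω i)) → (∀ b ∈ I, ∃ i, P b (ω i)) → G ω) :
    1 - N * (∑ x, if P z x then μ x else 0)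
        - ∑ b ∈ I, (1 - ∑ x, if P b x then μ x else 0) ^ N
      ≤ ∑ ω : Fin N → Ω, if G ω then ∏ i, μ (ω i) else 0 := by
  have hcompl : ∀ b, 1 - (∑ x, if P b x then μ x else 0) = ∑ x, if ¬ P b x then μ x else 0 := by
    intro b
    rw [← hμ1, ← Finset.sum_sub_distrib]
    refine Finset.sum_congr rfl fun x _ => ?_
    by_cases h : P b x <;> simp [h]
  have hz : 1 - N * (∑ x, if P z x then μ x else 0)
      ≤ (∑ x, if ¬ P z x then μ x else 0) ^ N := by
    have hle : (∑ x, if P z x then μ x else 0) ≤ 1 := by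
      rw [← hμ1]
      refine Finset.sum_le_sum fun x _ => ?_
      split_ifs
      · exact le_rfl
      · exact hμ x
    rw [← hcompl]
    have := one_add_mul_le_pow (a := -(∑ x, if P z x then μ x else 0)) (by linarith) N
    calc _ = 1 + (N : ℝ) * -(∑ x, if P z x then μ x else 0) := by ring
      _ ≤ _ := this
      _ = _ := by ring
  simp only [hcompl]
  rw [← sum_prod_ite_forall] at hz
  simp only [← sum_prod_ite_forall]
  refine (sub_le_sub_right hz _).trans ?_
  rw [sub_le_iff_le_add, Finset.sum_comm, ← Finset.sum_add_distrib]
  refine Finset.sum_le_sum fun ω _ => ?_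
  have hprod : 0 ≤ ∏ i, μ (ω i) := Finset.prod_nonneg fun i _ => hμ _
  have hsum : ∀ b ∈ I, 0 ≤ if ∀ i, ¬ P b (ω i) then ∏ i, μ (ω i) else 0 := fun b _ => by
    split_ifs
    · exact hprod
    · exact le_rfl
  by_cases h1 : ∀ i, ¬ P z (ω i)
  · rw [if_pos h1]
    by_cases h2 : ∀ b ∈ I, ∃ i, P b (ω i)
    · rw [if_pos (hG ω h1 h2)]
      exact le_add_of_nonneg_right (Finset.sum_nonneg hsum)
    · push Not at h2
      obtain ⟨b, hb, h2⟩ := h2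
      have h3 := Finset.single_le_sum hsum hb
      rw [if_pos h2] at h3
      refine h3.trans (le_add_of_nonneg_left ?_)
      split_ifs
      · exact hprod
      · exact le_rfl
  · rw [if_neg h1]
    refine add_nonneg ?_ (Finset.sum_nonneg hsum)
    split_ifs
    · exact hprod
    · exact le_rfl

theorem expect_pi_sum {I R : Type*} [Fintype I] [Fintype R] {N : ℕ}
    (q : I → R → ℝ) (G : (Fin N → I) → (Fin N → R) → Prop) [∀ x r, Decidable (G x r)] :
    𝔼 x : Fin N → I, ∑ r : Fin N → R, (if G x r then ∏ i, q (x i) (r i) else 0)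
      = ∑ ω : Fin N → I × R, if G (fun i => (ω i).1) (fun i => (ω i).2) then
          ∏ i, q (ω i).1 (ω i).2 / Fintype.card I else 0 := by
  rw [Fintype.expect_eq_sum_div_card, Finset.sum_div,
    ← Fintype.sum_equiv (Equiv.arrowProdEquivProdArrow (Fin N) (fun _ => I) (fun _ => R)).symm
      (fun p : (Fin N → I) × (Fin N → R) =>
        (if G p.1 p.2 then ∏ i, q (p.1 i) (p.2 i) else 0) / Fintype.card (Fin N → I)),
    Fintype.sum_prod_type]
  · refine Finset.sum_congr rfl fun x _ => ?_
    rw [Finset.sum_div]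
  · rintro ⟨x, r⟩
    change (if G x r then ∏ i, q (x i) (r i) else 0) / _
      = if G x r then ∏ i, q (x i) (r i) / Fintype.card I else 0
    split_ifs
    · rw [Finset.prod_div_distrib]
      simp
    · simp

/-! ### The inverter -/

theorem ofFn_bits {d : ℕ} (l : List Bool) (h : l.length = d) : List.ofFn (bits d l) = l := by
  subst h
  refine List.ext_getElem (by simp) fun i h1 h2 => ?_
  simp [bits, h2]

open Classical in
/-- The algorithm that obfuscates the circuits `C i y` with the coins `ρ i`, runs `A` on each of the
results, and recovers a string from the outputs. -/
theorem exists_inverter {iO : Obfuscator} {κ p k n m N : ℕ} (A : QCircuit k)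
    (D : BoolCircuit (descLen p 1 + iO.coins κ p) (descLen (iO.outSize κ p) 1))
    (hD : ∀ (C : BoolCircuit k 1) (ρ : Fin (iO.coins κ p) → Bool), C.size ≤ p →
      D.eval (bits _ (C.desc p ++ List.ofFn ρ)) =
        bits _ ((iO.obf κ p C ρ).desc (iO.outSize κ p)))
    (C : Fin N → (Fin m → Bool) → BoolCircuit k 1) (hC : ∀ i y, (C i y).size ≤ p)
    (hdesc : ∀ i, ListCost (coords (Fin m)) fun y => (C i y).desc p)
    (ρ : Fin N → Fin (iO.coins κ p) → Bool)
    (ζ : Fin N → Fin k → Vec k →ₗ[ZMod 2] ZMod 2)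
    (η : Fin N → Fin n → Vec k →ₗ[ZMod 2] ZMod 2) :
    ∃ B : QCircuit n, B.size ≤ 3 * (N * D.size) + N * A.size +
        2 * (n * n + N * recoverStepCost k n + n * (n * 9)) ∧
      ∀ (y : Fin m → Bool) (E : (Fin n → Bool) → Prop),
        B.prob (List.ofFn y) E = ∑ r : Fin N → Fin A.wires → Bool,
          if E (recover ζ η fun i j => r i (A.out j)) then
            ∏ i, ‖A.finalState ((iO.obf κ p (C i y) (ρ i)).desc (iO.outSize κ p)) (r i)‖ ^ 2
          else 0 := by
  let G : (Fin m → Bool) → Fin N → Fin (descLen (iO.outSize κ p) 1) → Bool := fun y i =>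
    bits _ ((iO.obf κ p (C i y) (ρ i)).desc (iO.outSize κ p))
  have h1 : ∀ i, GateCost (coords (Fin m)) D.size
      (Set.range fun (j : Fin (descLen (iO.outSize κ p) 1)) y => G y i j) := by
    intro i
    have h2 := (hdesc i).append (ListCost.const (List.ofFn (ρ i)))
    have h3 := GateCost.range (ι := Fin (descLen p 1 + iO.coins κ p))
      (p := fun a y => bits _ ((C i y).desc p ++ List.ofFn (ρ i)) a) fun a => h2.getD a
    have h4 := GateCost.comp (φ := fun y => bits (descLen p 1 + iO.coins κ p)
      ((C i y).desc p ++ List.ofFn (ρ i))) h3 D.gateCost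
    have h5 : (fun (j : Fin (descLen (iO.outSize κ p) 1)) y => G y i j) = fun j y =>
        D.eval (bits _ ((C i y).desc p ++ List.ofFn (ρ i))) j := by
      funext j y
      rw [hD _ _ (hC i y)]
    rw [h5]
    refine h4.of_le ?_
    rw [Fintype.card_fin, BoolCircuit.size]
    omega
  have hG : NandComputable (Equiv.refl (Fin m)) (N * D.size)
      (fun y (q : Fin N × Fin (descLen (iO.outSize κ p) 1)) => G y q.1 q.2) := by
    refine GateCost.nandComputable _
      (F := fun (q : Fin N × Fin (descLen (iO.outSize κ p) 1)) y => G y q.1 q.2) ?_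
    have := GateCost.iUnion h1
    rw [Fintype.card_fin] at this
    refine this.mono subset_rfl le_rfl ?_
    rintro _ ⟨q, rfl⟩
    exact Set.mem_iUnion.mpr ⟨q.1, q.2, rfl⟩
  obtain ⟨B, hB, h⟩ := QCircuit.exists_parallel A G hG (recover ζ η) (nandComputable_recover ζ η)
  have hdD : N * descLen (iO.outSize κ p) 1 ≤ N * D.size :=
    Nat.mul_le_mul_left _ (by rw [BoolCircuit.size]; omega)
  refine ⟨B, by omega, fun y E => ?_⟩
  rw [h]
  refine Finset.sum_congr rfl fun r _ => ?_
  refine if_congr Iff.rfl (Finset.prod_congr rfl fun i _ => ?_) rfl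
  rw [ofFn_bits _ (BoolCircuit.length_desc _ _)]

theorem mem_span_singleton_iff {M : Type*} [AddCommGroup M] [Module (ZMod 2) M] {a x : M} :
    x ∈ Submodule.span (ZMod 2) {a} ↔ x = 0 ∨ x = a := by
  rw [Submodule.mem_span_singleton]
  constructor
  · rintro ⟨r, rfl⟩
    rcases eq_or_ne r 0 with rfl | hr
    · left; simp
    · right; rw [(zmod_two_ne_zero_iff r).mp hr, one_smul]
  · rintro (rfl | rfl)
    · exact ⟨0, by simp⟩
    · exact ⟨1, by simp⟩

open Classical in
/-- Recovery succeeds once no output hits at the secret and every other nonzero point is hit. -/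
theorem recover_eq {N k n c : ℕ} {L : Fin N → Vec k →ₗ[ZMod 2] (Fin n ⊕ Fin c → ZMod 2)}
    {ζ : Fin N → Fin k → Vec k →ₗ[ZMod 2] ZMod 2} {η : Fin N → Fin n → Vec k →ₗ[ZMod 2] ZMod 2}
    (h : ∀ i u b, decode (ζ i) (η i) u ⬝ᵥ b = 1 ↔ Hits (L i) (Sum.elim b 0) u)
    {z : Fin n → Bool} (hz : toVec z ≠ 0) (u : Fin N → Fin k → Bool)
    (h0 : ∀ i, ¬ Hits (L i) (Sum.elim (toVec z) 0) (toVec (u i)))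
    (h1 : ∀ b ∈ Finset.univ.filter fun b : Vec n => b ≠ 0 ∧ b ≠ toVec z,
      ∃ i, Hits (L i) (Sum.elim b 0) (toVec (u i))) :
    recover ζ η u = z := by
  have key := sum_elim_eq ((List.finRange N).map fun l => decode (ζ l) (η l) (toVec (u l)))
    (toVec z) hz fun v => by
      constructor
      · intro hv
        by_contra hc
        push Not at hc
        obtain ⟨i, hi⟩ := h1 v (by simpa using hc)
        rw [← h] at hi
        rw [hv _ (List.mem_map.mpr ⟨i, List.mem_finRange i, rfl⟩)] at hi
        exact absurd hi (by decide)
      · rintro (rfl | rfl) w hw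
        · exact dotProduct_zero w
        · obtain ⟨i, -, rfl⟩ := List.mem_map.mp hw
          by_contra hc
          exact h0 i ((h i _ _).mp ((zmod_two_ne_zero_iff _).mp hc))
  funext i
  rw [recover, key, bitOf_toVec]

open Classical in
/-- The success probability of the inverter, averaged over the surjections and the coins. -/
theorem le_expect_recover {iO : Obfuscator} {κ p k n c N : ℕ} (A : QCircuit k)
    (𝓛 : Finset (Vec k →ₗ[ZMod 2] (Fin n ⊕ Fin c → ZMod 2))) (h𝓛 : 𝓛.Nonempty)
    (C : 𝓛 → BoolCircuit k 1)
    (ζ : 𝓛 → Fin k → Vec k →ₗ[ZMod 2] ZMod 2) (η : 𝓛 → Fin n → Vec k →ₗ[ZMod 2] ZMod 2)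
    (h : ∀ L u b, decode (ζ L) (η L) u ⬝ᵥ b = 1 ↔ Hits L.1 (Sum.elim b 0) u)
    {z : Fin n → Bool} (hz : toVec z ≠ 0) :
    1 - N * (𝔼 L : 𝓛, iO.probOn κ p (C L) A fun u =>
          Hits L.1 (Sum.elim (toVec z) 0) (toVec u))
        - ∑ b ∈ Finset.univ.filter fun b : Vec n => b ≠ 0 ∧ b ≠ toVec z,
          (1 - 𝔼 L : 𝓛, iO.probOn κ p (C L) A fun u => Hits L.1 (Sum.elim b 0) (toVec u)) ^ N
      ≤ 𝔼 x : Fin N → 𝓛 × (Fin (iO.coins κ p) → Bool), ∑ r : Fin N → Fin A.wires → Bool,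
        if recover (fun i => ζ (x i).1) (fun i => η (x i).1) (fun i j => r i (A.out j)) = z then
          ∏ i, ‖A.finalState ((iO.obf κ p (C (x i).1) (x i).2).desc (iO.outSize κ p)) (r i)‖ ^ 2
        else 0 := by
  have : Nonempty 𝓛 := h𝓛.to_subtype
  let I := 𝓛 × (Fin (iO.coins κ p) → Bool)
  let q : I → (Fin A.wires → Bool) → ℝ := fun x r =>
    ‖A.finalState ((iO.obf κ p (C x.1) x.2).desc (iO.outSize κ p)) r‖ ^ 2
  rw [expect_pi_sum (I := I) q fun x r => recover (fun i => ζ (x i).1) (fun i => η (x i).1)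
    (fun i j => r i (A.out j)) = z]
  have hP : ∀ b : Vec n, (𝔼 L : 𝓛, iO.probOn κ p (C L) A fun u =>
        Hits L.1 (Sum.elim b 0) (toVec u))
      = ∑ x : I × (Fin A.wires → Bool),
        if Hits x.1.1.1 (Sum.elim b 0) (toVec fun j => x.2 (A.out j)) then
          q x.1 x.2 / Fintype.card I else 0 := by
    intro b
    rw [Fintype.expect_eq_sum_div_card, Finset.sum_div, Fintype.sum_prod_type,
      Fintype.sum_prod_type]
    refine Finset.sum_congr rfl fun L _ => ?_
    rw [Obfuscator.probOn_eq_sum, Fintype.sum_prod_type, Finset.sum_div]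
    refine Finset.sum_congr rfl fun ρ _ => ?_
    rw [Finset.sum_div]
    refine Finset.sum_congr rfl fun r _ => ?_
    split_ifs
    · rw [div_div, Fintype.card_prod, Nat.cast_mul, mul_comm (Fintype.card 𝓛 : ℝ)]
    · simp
  simp only [hP]
  refine le_of_le_of_eq (union_bound (fun x : I × (Fin A.wires → Bool) => q x.1 x.2 / Fintype.card I)
    (fun x => by positivity) ?_
    (fun (b : Vec n) x => Hits x.1.1.1 (Sum.elim b 0) (toVec fun j => x.2 (A.out j))) (toVec z) _ _
    (fun ω h0 h1 => recover_eq (L := fun i => (ω i).1.1.1) (fun i => h _) hz _ h0 h1)) (by congr!)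
  rw [Fintype.sum_prod_type]
  have : ∀ x : I, ∑ r, q x r / Fintype.card I = 1 / Fintype.card I := by
    intro x
    rw [← Finset.sum_div]
    congr 1
    exact A.sum_normSq_finalState _
  simp only [this, Finset.sum_const, Finset.card_univ, nsmul_eq_mul]
  exact mul_one_div_cancel (Nat.cast_ne_zero.mpr Fintype.card_ne_zero)

/-! ### Numerical estimates -/

/-- The union bound over `N ≈ 6 (t + 1) / ε` samples: the first term is at most `21 / 64` because
`N ≤ 7 (t + 1) / ε`, and the second is at most `2 ^ (t + 1) * exp (-2 (t + 1)) ≤ 4 / 49` because a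
single sample hits with probability at least `ε / 3`. -/
theorem failure_le_half {k t lam N : ℕ} {ε δ x : ℝ} (hk : 2 ≤ k) (ht : 1 ≤ t) (hlam : lam ≤ t)
    (hε : 0 < ε) (hε1 : ε ≤ 1) (hN : N = ⌈6 * ((t : ℝ) + 1) / ε⌉₊)
    (hδ : δ ≤ ε / (16 * k * (t + 1))) (hx0 : 0 ≤ x) (hx : x ≤ ε / (32 * k * (t + 1))) :
    N * (δ + x) + 2 ^ lam * (1 - (ε / 2 - x)) ^ N ≤ 1 / 2 := by
  have hk' : (2 : ℝ) ≤ k := by exact_mod_cast hk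
  have ht' : (1 : ℝ) ≤ t := by exact_mod_cast ht
  have hN1 : 6 * ((t : ℝ) + 1) / ε ≤ N := by rw [hN]; exact Nat.le_ceil _
  have hN2 : (N : ℝ) ≤ 7 * ((t : ℝ) + 1) / ε := by
    have h1 : (N : ℝ) < 6 * ((t : ℝ) + 1) / ε + 1 := by
      rw [hN]; exact Nat.ceil_lt_add_one (by positivity)
    have h2 : (1 : ℝ) ≤ (t + 1) / ε := by rw [le_div_iff₀ hε]; linarith
    have h3 : 7 * ((t : ℝ) + 1) / ε = 6 * ((t : ℝ) + 1) / ε + (t + 1) / ε := by ring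
    linarith
  have hA : N * (δ + x) ≤ 21 / 64 := by
    have h1 : δ + x ≤ 3 * ε / (32 * k * (t + 1)) := by
      have : ε / (16 * k * (t + 1)) + ε / (32 * k * (t + 1)) = 3 * ε / (32 * k * (t + 1)) := by
        field_simp; norm_num
      linarith
    calc N * (δ + x) ≤ N * (3 * ε / (32 * k * (t + 1))) :=
          mul_le_mul_of_nonneg_left h1 (Nat.cast_nonneg _)
      _ ≤ 7 * ((t : ℝ) + 1) / ε * (3 * ε / (32 * k * (t + 1))) :=
          mul_le_mul_of_nonneg_right hN2 (by positivity)
      _ = 21 / (32 * k) := by field_simp; norm_num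
      _ ≤ 21 / 64 := by
          apply div_le_div_of_nonneg_left <;> linarith
  have hx3 : ε / 3 ≤ ε / 2 - x := by
    have h1 : x ≤ ε / 32 := hx.trans (by
      apply div_le_div_of_nonneg_left hε.le (by norm_num)
      nlinarith)
    linarith
  have hB : 2 ^ lam * (1 - (ε / 2 - x)) ^ N ≤ (4 / 49 : ℝ) := by
    have h0 : 0 ≤ 1 - (ε / 2 - x) := by linarith
    have h1 : (1 - (ε / 2 - x)) ^ N ≤ Real.exp (-(2 * (t + 1))) := by
      calc (1 - (ε / 2 - x)) ^ N ≤ Real.exp (-(ε / 3)) ^ N := by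
            apply pow_le_pow_left₀ h0
            have := Real.add_one_le_exp (-(ε / 3))
            linarith
        _ = Real.exp (-(N * (ε / 3))) := by rw [← Real.exp_nat_mul]; ring_nf
        _ ≤ Real.exp (-(2 * (t + 1))) := by
            apply Real.exp_le_exp.mpr
            rw [div_le_iff₀ hε] at hN1
            linarith
    have h2 : Real.exp (-(2 * ((t : ℝ) + 1))) ≤ (1 / 7) ^ (t + 1) := by
      have h3 : Real.exp (-2) ≤ 1 / 7 := by
        rw [Real.exp_neg, ← one_div]
        apply one_div_le_one_div_of_le (by norm_num)
        have h4 : Real.exp 2 = Real.exp 1 * Real.exp 1 := by rw [← Real.exp_add]; norm_num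
        have := Real.exp_one_gt_d9
        rw [h4]
        nlinarith
      calc Real.exp (-(2 * ((t : ℝ) + 1))) = Real.exp (-2) ^ (t + 1) := by
            rw [← Real.exp_nat_mul]
            congr 1
            push_cast
            ring
        _ ≤ _ := pow_le_pow_left₀ (Real.exp_pos _).le h3 _
    calc 2 ^ lam * (1 - (ε / 2 - x)) ^ N ≤ 2 ^ (t + 1) * (1 / 7) ^ (t + 1) :=
          mul_le_mul (pow_le_pow_right₀ (by norm_num) (by omega)) (h1.trans h2)
            (pow_nonneg h0 _) (by positivity)
      _ = (2 / 7 : ℝ) ^ (t + 1) := by rw [← mul_pow]; norm_num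
      _ ≤ (2 / 7 : ℝ) ^ 2 := pow_le_pow_of_le_one (by norm_num) (by norm_num) (by omega)
      _ = 4 / 49 := by norm_num
  linarith

theorem superspaceExperiment_le_one (iO : Obfuscator)
    (CM : (k : ℕ) → Submodule (ZMod 2) (Vec k) → BoolCircuit k 1) (κ p : ℕ) {k : ℕ}
    (S : Submodule (ZMod 2) (Vec k)) (d : ℕ) (A : QCircuit k)
    (E : Submodule (ZMod 2) (Vec k) → Vec k → Prop) :
    superspaceExperiment iO CM κ p S d A E ≤ 1 := by
  rw [superspaceExperiment]
  rcases (superspaces S d).eq_empty_or_nonempty with h | h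
  · simp [h]
  · exact Finset.expect_le h fun _ _ => iO.probOn_le_one _ _ _

/-! ### The reduction -/

section Reduction

variable {iO : Obfuscator} {CM : (k : ℕ) → Submodule (ZMod 2) (Vec k) → BoolCircuit k 1}
  {κ p k n c m : ℕ} {f : ℕ → ℕ} {ε' : ℕ → ℝ} {A : QCircuit k}

theorem expect_univ_coe {α : Type*} (s : Finset α) (g : α → ℝ) : 𝔼 a : s, g a = 𝔼 a ∈ s, g a := by
  rw [Fintype.expect_eq_sum_div_card, Finset.expect_eq_sum_div_card, Finset.sum_coe_sort,
    Fintype.card_coe]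

/-- Obfuscations of the point test of `F z` and of the membership circuit of the preimage of the
line of `z` are indistinguishable, since both circuits compute the same function. -/
theorem abs_probOn_pointTest_sub_le (hS : iO.Secure f ε')
    (hCM : IsMembershipFamily CM) (hCMp : ∀ T, (CM k T).size ≤ p)
    (hf : descLen (iO.outSize κ p) 1 + A.size + 2 * hitCost k n ≤ f κ)
    {F : (Fin n → Bool) → (Fin m → Bool)} (hF : Function.Injective F)
    {L : Vec k →ₗ[ZMod 2] (Fin n ⊕ Fin c → ZMod 2)} (hL : Function.Surjective L)
    {C : BoolCircuit k 1} (hCp : C.size ≤ p) {z : Fin n → Bool}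
    (hC : ∀ v, C.eval v 0 = pointTest L F (F z) v) (b : Vec n) :
    |iO.probOn κ p C A (fun u => Hits L (Sum.elim b 0) (toVec u))
      - iO.probOn κ p (CM k ((Submodule.span (ZMod 2) {Sum.elim (toVec z) 0}).comap L)) A
        (fun u => Hits L (Sum.elim b 0) (toVec u))| ≤ ε' κ := by
  obtain ⟨P, hP, hPc⟩ := exists_hits_cost hL b
  refine hS.abs_probOn_sub_le ?_ hCp (hCMp _) A _ P hP hPc hf
  funext v j
  rw [Fin.fin_one_eq_zero j, Bool.eq_iff_iff, hC, pointTest_eq_true L hF, hCM.correct,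
    Submodule.mem_comap, mem_span_singleton_iff]

/-- For a fixed nonzero secret, the inverter succeeds with good probability. -/
theorem le_expect_recover_pointTest (hS : iO.Secure f ε')
    (hCM : IsMembershipFamily CM) (hCMp : ∀ T, (CM k T).size ≤ p)
    (hf : descLen (iO.outSize κ p) 1 + A.size + 2 * hitCost k n ≤ f κ)
    {F : (Fin n → Bool) → (Fin m → Bool)} (hF : Function.Injective F)
    {S : Submodule (ZMod 2) (Vec k)} {d N : ℕ} {ε δ : ℝ}
    (hk : Module.finrank (ZMod 2) S + (n + c) ≤ k) (hd : d + (n + c) = k + 1)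
    (hε : ε ≤ superspaceExperiment iO CM κ p S d A (fun T u => u ∈ perp T ∧ u ≠ 0))
    (hδ : superspaceExperiment iO CM κ p S d A (fun T u => u ∈ perp S ∧ u ∉ perp T) ≤ δ)
    (h0 : 0 ≤ 1 - (ε / 2 - ε' κ))
    (C : surjections S (Fin n ⊕ Fin c) → BoolCircuit k 1) (hCp : ∀ L, (C L).size ≤ p)
    (ζ : surjections S (Fin n ⊕ Fin c) → Fin k → Vec k →ₗ[ZMod 2] ZMod 2)
    (η : surjections S (Fin n ⊕ Fin c) → Fin n → Vec k →ₗ[ZMod 2] ZMod 2)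
    (h : ∀ L u b, decode (ζ L) (η L) u ⬝ᵥ b = 1 ↔ Hits L.1 (Sum.elim b 0) u)
    {z : Fin n → Bool} (hz : toVec z ≠ 0)
    (hC : ∀ L v, (C L).eval v 0 = pointTest L.1 F (F z) v)
    [∀ y : Fin n → Bool, Decidable (y = z)] :
    1 - (N * (δ + ε' κ) + 2 ^ n * (1 - (ε / 2 - ε' κ)) ^ N) ≤
      𝔼 x : Fin N → surjections S (Fin n ⊕ Fin c) × (Fin (iO.coins κ p) → Bool),
        ∑ r : Fin N → Fin A.wires → Bool,
        if recover (fun i => ζ (x i).1) (fun i => η (x i).1) (fun i j => r i (A.out j)) = z then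
          ∏ i, ‖A.finalState ((iO.obf κ p (C (x i).1) (x i).2).desc (iO.outSize κ p)) (r i)‖ ^ 2
        else 0 := by
  classical
  have hk' : Module.finrank (ZMod 2) S + Fintype.card (Fin n ⊕ Fin c) ≤ k := by simpa using hk
  have hd' : d + Fintype.card (Fin n ⊕ Fin c) = k + 1 := by simpa using hd
  have hne := surjections_nonempty S (Fin n ⊕ Fin c) hk'
  have : Nonempty (surjections S (Fin n ⊕ Fin c)) := hne.to_subtype
  have hz' : (Sum.elim (toVec z) 0 : Fin n ⊕ Fin c → ZMod 2) ≠ 0 := fun h0 =>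
    hz (funext fun i => congrFun h0 (.inl i))
  have habs : ∀ b : Vec n, |(𝔼 L : surjections S (Fin n ⊕ Fin c), iO.probOn κ p (C L) A
        (fun u => Hits L.1 (Sum.elim b 0) (toVec u)))
      - 𝔼 L ∈ surjections S (Fin n ⊕ Fin c), iO.probOn κ p
        (CM k ((Submodule.span (ZMod 2) {Sum.elim (toVec z) 0}).comap L)) A
        (fun u => Hits L (Sum.elim b 0) (toVec u))| ≤ ε' κ := by
    intro b
    rw [← expect_univ_coe (surjections S _) fun L => iO.probOn κ p
      (CM k ((Submodule.span (ZMod 2) {Sum.elim (toVec z) 0}).comap L)) A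
      (fun u => Hits L (Sum.elim b 0) (toVec u)), ← Finset.expect_sub_distrib]
    refine (Finset.abs_expect_le _ _).trans (Finset.expect_le Finset.univ_nonempty fun L _ => ?_)
    exact abs_probOn_pointTest_sub_le hS hCM hCMp hf hF (mem_surjections.mp L.2).1 (hCp L) (hC L) b
  have hA := le_expect_recover (iO := iO) (κ := κ) (p := p) (N := N) A _ hne C ζ η h hz
  refine le_trans ?_ (hA.trans_eq (by congr!))
  have h1 : (𝔼 L : surjections S (Fin n ⊕ Fin c), iO.probOn κ p (C L) A
      fun u => Hits L.1 (Sum.elim (toVec z) 0) (toVec u)) ≤ δ + ε' κ := by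
    have h2 := (expect_hits_le iO CM κ p S A hk' hz' hd').trans hδ
    have h3 := (abs_le.mp (habs (toVec z))).2
    linarith
  have h4 : ∀ b ∈ Finset.univ.filter fun b : Vec n => b ≠ 0 ∧ b ≠ toVec z,
      (1 - 𝔼 L : surjections S (Fin n ⊕ Fin c), iO.probOn κ p (C L) A
        fun u => Hits L.1 (Sum.elim b 0) (toVec u)) ^ N ≤ (1 - (ε / 2 - ε' κ)) ^ N := by
    intro b hb
    rw [Finset.mem_filter] at hb
    have hb' : (Sum.elim b 0 : Fin n ⊕ Fin c → ZMod 2) ∉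
        Submodule.span (ZMod 2) {Sum.elim (toVec z) 0} := by
      rw [mem_span_singleton_iff]
      rintro (h | h)
      · exact hb.2.1 (funext fun i => congrFun h (.inl i))
      · exact hb.2.2 (funext fun i => congrFun h (.inl i))
    refine pow_le_pow_left₀ ?_ ?_ N
    · exact sub_nonneg.mpr (Finset.expect_le Finset.univ_nonempty fun _ _ =>
        iO.probOn_le_one _ _ _)
    · have h2 := hε.trans (experiment_le_two_mul_expect_hits iO CM κ p S A hk' hz' hb' hd')
      have h3 := (abs_le.mp (habs b)).1
      linarith
  have h5 := Finset.sum_le_card_nsmul _ _ _ h4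
  have h6 : (((Finset.univ.filter fun b : Vec n => b ≠ 0 ∧ b ≠ toVec z).card : ℕ) : ℝ)
      ≤ 2 ^ n := by
    have : (Finset.univ.filter fun b : Vec n => b ≠ 0 ∧ b ≠ toVec z).card ≤ 2 ^ n :=
      (Finset.card_le_univ _).trans_eq (by simp [ZMod.card])
    exact_mod_cast this
  rw [nsmul_eq_mul] at h5
  have h7 := mul_le_mul_of_nonneg_right h6 (pow_nonneg h0 N)
  have h8 := mul_le_mul_of_nonneg_left h1 (Nat.cast_nonneg (α := ℝ) N)
  linarith

open Classical in
/-- If no inverter of the given size succeeds on a uniformly random `z` with probability greater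
than `θ`, then this bounds the probability with which `A` separates `z` from all other points. Every
choice of surjections and coins can be hardwired into an inverter; the bound `θ` holds for each of
these inverters, hence for the average over them. The factor `1 - 1 / 2 ^ n` accounts for
`z = 0`. -/
theorem inversion_bound (hS : iO.Secure f ε')
    (hCM : IsMembershipFamily CM) (hCMp : ∀ T, (CM k T).size ≤ p)
    (hf : descLen (iO.outSize κ p) 1 + A.size + 2 * hitCost k n ≤ f κ)
    (DF : BoolCircuit n m) (hF : Function.Injective DF.eval)
    (hp : k + (1 + m + pointTestCost k n c m DF.gates.length) + 1 ≤ p)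
    (D : BoolCircuit (descLen p 1 + iO.coins κ p) (descLen (iO.outSize κ p) 1))
    (hD : ∀ (C : BoolCircuit k 1) (ρ : Fin (iO.coins κ p) → Bool), C.size ≤ p →
      D.eval (bits _ (C.desc p ++ List.ofFn ρ)) =
        bits _ ((iO.obf κ p C ρ).desc (iO.outSize κ p)))
    {S : Submodule (ZMod 2) (Vec k)} {d N : ℕ} {ε δ θ : ℝ}
    (hk : Module.finrank (ZMod 2) S + (n + c) ≤ k) (hd : d + (n + c) = k + 1)
    (hε : ε ≤ superspaceExperiment iO CM κ p S d A (fun T u => u ∈ perp T ∧ u ≠ 0))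
    (hδ : superspaceExperiment iO CM κ p S d A (fun T u => u ∈ perp S ∧ u ∉ perp T) ≤ δ)
    (h0 : 0 ≤ 1 - (ε / 2 - ε' κ))
    (hθ : ∀ B : QCircuit n, B.size ≤ 3 * (N * D.size) + N * A.size +
        2 * (n * n + N * recoverStepCost k n + n * (n * 9)) →
      𝔼 z : Fin n → Bool, B.prob (List.ofFn (DF.eval z)) (fun z' => DF.eval z' = DF.eval z) ≤ θ) :
    (1 - 1 / 2 ^ n) * (1 - (N * (δ + ε' κ) + 2 ^ n * (1 - (ε / 2 - ε' κ)) ^ N)) ≤ θ := by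
  set γ := 1 - (N * (δ + ε' κ) + 2 ^ n * (1 - (ε / 2 - ε' κ)) ^ N) with hγ
  have hk' : Module.finrank (ZMod 2) S + Fintype.card (Fin n ⊕ Fin c) ≤ k := by simpa using hk
  have hne := surjections_nonempty S (Fin n ⊕ Fin c) hk'
  have : Nonempty (surjections S (Fin n ⊕ Fin c)) := hne.to_subtype
  choose C hC1 hC2 hC3 using fun L : surjections S (Fin n ⊕ Fin c) =>
    exists_pointTest_circuit L.1 DF hp
  choose ζ η h using fun L : surjections S (Fin n ⊕ Fin c) =>
    exists_decode_iff_hits (mem_surjections.mp L.2).1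
  let succ : (Fin n → Bool) → (Fin N → surjections S (Fin n ⊕ Fin c) ×
      (Fin (iO.coins κ p) → Bool)) → ℝ := fun z x => ∑ r : Fin N → Fin A.wires → Bool,
    if recover (fun i => ζ (x i).1) (fun i => η (x i).1) (fun i j => r i (A.out j)) = z then
      ∏ i, ‖A.finalState ((iO.obf κ p (C (x i).1 (DF.eval z)) (x i).2).desc
        (iO.outSize κ p)) (r i)‖ ^ 2
    else 0
  have hup : ∀ x, 𝔼 z, succ z x ≤ θ := by
    intro x
    obtain ⟨B, hB, hB'⟩ := exists_inverter A D hD (fun i => C (x i).1) (fun i => hC1 _)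
      (fun i => hC3 _) (fun i => (x i).2) (fun i => ζ (x i).1) (fun i => η (x i).1)
    refine le_of_eq_of_le (Finset.expect_congr rfl fun z _ => ?_) (hθ B hB)
    rw [hB']
    simp only [succ, hF.eq_iff]
  have hlow : ∀ z : Fin n → Bool, (if toVec z = 0 then 0 else γ) ≤ 𝔼 x, succ z x := by
    intro z
    split_ifs with hz
    · exact Finset.expect_nonneg fun x _ => Finset.sum_nonneg fun r _ => by
        split_ifs
        · positivity
        · exact le_rfl
    · exact le_expect_recover_pointTest hS hCM hCMp hf hF hk hd hε hδ h0
        (fun L => C L (DF.eval z)) (fun L => hC1 L _) ζ η h hz (fun L v => hC2 L _ v)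
  have hle : 𝔼 z : Fin n → Bool, (if toVec z = 0 then 0 else γ) ≤ θ := by
    refine (Finset.expect_le_expect fun z _ => hlow z).trans ?_
    rw [Finset.expect_comm]
    exact Finset.expect_le Finset.univ_nonempty fun x _ => hup x
  refine le_of_eq_of_le ?_ hle
  have hzero : ∀ z : Fin n → Bool, toVec z = 0 ↔ z = fun _ => false := by
    intro z
    simp [funext_iff, toVec]
  have : ∀ z : Fin n → Bool, (if toVec z = 0 then 0 else γ)
      = γ - if z = (fun _ => false) then γ else 0 := by
    intro z
    simp only [hzero]
    split_ifs <;> simp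
  simp only [this]
  rw [Fintype.expect_eq_sum_div_card, Finset.sum_sub_distrib, Finset.sum_ite_eq']
  simp
  field_simp

end Reduction

/-! ### Choice of parameters -/

theorem superspaceExperiment_dim_zero (iO : Obfuscator)
    (CM : (k : ℕ) → Submodule (ZMod 2) (Vec k) → BoolCircuit k 1) (κ p : ℕ)
    (S : Submodule (ZMod 2) (Vec 0)) (d : ℕ) (A : QCircuit 0) :
    superspaceExperiment iO CM κ p S d A (fun T u => u ∈ perp T ∧ u ≠ 0) = 0 := by
  have h : ∀ (T : Submodule (ZMod 2) (Vec 0)) (u : Vec 0), (u ∈ perp T ∧ u ≠ 0) ↔ False :=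
    fun T u => iff_false_intro fun hu => hu.2 (Subsingleton.elim _ _)
  simp only [superspaceExperiment, Obfuscator.probOn, QCircuit.prob, h, if_false,
    Finset.sum_const_zero, Finset.expect_const_zero]

/-- The function on the empty string is inverted with certainty. -/
theorem IsInjectiveOWF.one_le_of_zero {outLen : ℕ → ℕ}
    {F : (n : ℕ) → (Fin n → Bool) → (Fin (outLen n) → Bool)} {f : ℕ → ℕ} {ε : ℕ → ℝ}
    (hF : IsInjectiveOWF F f ε) : 1 ≤ ε 0 := by
  let B : QCircuit 0 := ⟨0, [], Fin.elim0⟩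
  refine le_of_eq_of_le ?_ (hF.secure 0 B (Nat.zero_le _))
  rw [← Fintype.expect_const (ι := Fin 0 → Bool) (1 : ℝ)]
  refine Finset.expect_congr rfl fun x _ => ?_
  rw [← B.sum_normSq_finalState (List.ofFn (F 0 x)), QCircuit.prob]
  refine Finset.sum_congr rfl fun v _ => ?_
  rw [if_pos (congrArg _ (Subsingleton.elim _ _))]

theorem natEval_le_natEval (P : Polynomial ℕ) {a b : ℕ} (h : a ≤ b) : P.eval a ≤ P.eval b := by
  rw [Polynomial.eval_eq_sum_range, Polynomial.eval_eq_sum_range]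
  exact Finset.sum_le_sum fun i _ => by gcongr

theorem pointTestCost_le {k lam c m d K Q : ℕ} (hk : k ≤ K) (hlam : lam ≤ K) (hc : c ≤ K)
    (hm : m ≤ Q) (hd : d ≤ Q) : pointTestCost k lam c m d ≤ pointTestCost K K K Q Q := by
  unfold pointTestCost
  gcongr

theorem recoverStepCost_le {k n K : ℕ} (hk : k ≤ K) (hn : n ≤ K) :
    recoverStepCost k n ≤ recoverStepCost K K := by
  unfold recoverStepCost
  gcongr

theorem hitCost_le {k n K : ℕ} (hk : k ≤ K) (hn : n ≤ K) : hitCost k n ≤ hitCost K K := by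
  unfold hitCost
  gcongr

theorem inverterSize_le {N : ℕ} (a b n r : ℕ) (hN : 1 ≤ N) :
    3 * (N * a) + N * b + 2 * (n * n + N * r + n * (n * 9)) ≤
      N * (3 * a + b + 2 * r + 20 * (n * n)) := by
  calc _ = N * (3 * a + b + 2 * r) + 20 * (n * n) := by ring
    _ ≤ N * (3 * a + b + 2 * r) + N * (20 * (n * n)) :=
        Nat.add_le_add_left (Nat.le_mul_of_pos_left _ hN) _
    _ = _ := by ring

/-- The padded size has room both for the membership circuits and for the point tests. -/
theorem exists_polynomial_circuitSize (K Q₁ Q₂ : Polynomial ℕ) : ∃ P : Polynomial ℕ, ∀ n,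
    P.eval n = Q₁.eval (K.eval n) + (K.eval n + (1 + Q₂.eval n +
      pointTestCost (K.eval n) (K.eval n) (K.eval n) (Q₂.eval n) (Q₂.eval n)) + 1) :=
  ⟨Q₁.comp K + (K + (1 + Q₂ + ((1 + K * (9 * K + 3)) + ((1 + K * (9 * K + 3)) +
    (K * (9 * K) + Q₂ + (1 + Q₂ * 12)) + 3) + 2)) + 1), fun n => by
      simp [pointTestCost, Polynomial.eval_comp]⟩

/-- The overhead of the inverter per sample, together with that of the distinguisher. The summand
`4` excludes small values of `f`. -/
theorem exists_polynomial_overhead (K κ p Q : Polynomial ℕ) : ∃ P : Polynomial ℕ, ∀ n,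
    P.eval n = 3 * Q.eval (κ.eval n + p.eval n) + 2 * recoverStepCost (K.eval n) (K.eval n)
      + 20 * K.eval n ^ 2 + 2 * hitCost (K.eval n) (K.eval n) + 4 :=
  ⟨3 * Q.comp (κ + p) + 2 * (((1 + K * (9 * K + 3)) + K * (9 * K + 2)) + (36 * K ^ 2 + 3 * K))
    + 20 * K ^ 2 + 2 * (((1 + K * (9 * K + 3)) + K * (9 * K + 2)) + K * 12) + 4, fun n => by
      simp [recoverStepCost, hitCost, Polynomial.eval_comp]⟩

end DualSubspace

open DualSubspace
theorem mainTheorem10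
    (iO : Obfuscator) (f_iO : ℕ → ℕ) (ε_iO : ℕ → ℝ) (hiO : IsIO iO f_iO ε_iO)
    (outLen : ℕ → ℕ) (F : (n : ℕ) → (Fin n → Bool) → (Fin (outLen n) → Bool))
    (f_OWF : ℕ → ℕ) (ε_OWF : ℕ → ℝ) (hF : IsInjectiveOWF F f_OWF ε_OWF)
    (CM : (k : ℕ) → Submodule (ZMod 2) (Vec k) → BoolCircuit k 1) (hCM : IsMembershipFamily CM)
    -- `K` bounds the dimension `k`, and `κ` is the security parameter handed to the obfuscator
    (K κ : Polynomial ℕ) :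
    ∃ p₀ : Polynomial ℕ, ∀ p : Polynomial ℕ, (∀ n, p₀.eval n ≤ p.eval n) →
    ∃ q : Polynomial ℕ,
    ∀ (lam k r s t : ℕ) (S : Submodule (ZMod 2) (Vec k)),
      r + s ≤ k → Module.finrank (ZMod 2) S = r → t = k - r - s →
      lam ≤ t → k ≤ K.eval lam →
    ∀ (A : QCircuit k) (T_A : ℕ) (ε ℓ : ℝ) (f : ℕ),
      A.size ≤ T_A →
      0 < ε →
      f = min (f_OWF lam) (f_iO (κ.eval lam)) → 0 < f →
      max (ε_OWF lam) (ε_iO (κ.eval lam)) ≤ 1 / (f : ℝ) →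
      ℓ = k * (t + 1) / ε →
      superspaceExperiment iO CM (κ.eval lam) (p.eval lam) S (r + s) A
        (fun T u => u ∈ perp T ∧ u ≠ 0) ≥ ε →
      (t : ℝ) / (2 : ℝ) ^ ((s : ℤ) - (t : ℤ)) ≤ ε / 2 →
      ℓ * ((k : ℝ) ^ 3 + ((q.eval lam : ℕ) : ℝ) + (T_A : ℝ)) / (f : ℝ) ≤ 1 / 8 →
      superspaceExperiment iO CM (κ.eval lam) (p.eval lam) S (r + s) A
        (fun T u => u ∈ perp S ∧ u ∉ perp T) ≥ ε / (16 * k * (t + 1)) := by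
  classical
  obtain ⟨Q₁, hQ₁⟩ := hCM.efficient
  obtain ⟨Q₂, hQ₂⟩ := hF.efficient
  obtain ⟨Q₃, hQ₃⟩ := hiO.efficient
  obtain ⟨p₀, hp₀⟩ := exists_polynomial_circuitSize K Q₁ Q₂
  refine ⟨p₀, fun p hp => ?_⟩
  obtain ⟨q, hq⟩ := exists_polynomial_overhead K κ p Q₃
  refine ⟨q, fun lam k r s t S hrs hr ht hlam hk A T_A ε ℓ f hA hε hf hf0 hmax hℓ hE h1 h2 => ?_⟩
  by_contra hcon
  push Not at hcon
  have hε1 : ε ≤ 1 := hE.le.trans (superspaceExperiment_le_one _ _ _ _ _ _ _ _)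
  -- in dimension zero there is no nonzero vector to be output
  rcases Nat.eq_zero_or_pos k with rfl | hk0
  · rw [superspaceExperiment_dim_zero] at hE
    exact absurd hE (not_le.mpr hε)
  have hfR : (0 : ℝ) < f := by exact_mod_cast hf0
  have hkR : (1 : ℝ) ≤ k := by exact_mod_cast hk0
  have hq4 : 4 ≤ q.eval lam := by rw [hq]; omega
  have hq4' : (4 : ℝ) ≤ (q.eval lam : ℕ) := by exact_mod_cast hq4
  have hxO := (le_max_left _ _).trans hmax
  have hxI := (le_max_right _ _).trans hmax
  -- the adversary and the reduction are small compared with `f`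
  have hbig : 8 * (k * ((t : ℝ) + 1) / ε) * ((q.eval lam : ℕ) + (T_A : ℝ)) ≤ f := by
    rw [div_le_iff₀ hfR, hℓ] at h2
    have h3 : k * ((t : ℝ) + 1) / ε * (((q.eval lam : ℕ) : ℝ) + T_A) ≤
        k * ((t : ℝ) + 1) / ε * ((k : ℝ) ^ 3 + ((q.eval lam : ℕ) : ℝ) + T_A) := by
      refine mul_le_mul_of_nonneg_left ?_ (by positivity)
      have : (0 : ℝ) ≤ (k : ℝ) ^ 3 := by positivity
      linarith
    linarith
  have hratio : ((t : ℝ) + 1) / ε ≤ k * ((t : ℝ) + 1) / ε := by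
    refine div_le_div_of_nonneg_right ?_ hε.le
    exact le_mul_of_one_le_left (by positivity) hkR
  have hone : 1 ≤ ((t : ℝ) + 1) / ε := by
    rw [le_div_iff₀ hε]
    have : (0 : ℝ) ≤ t := Nat.cast_nonneg t
    linarith
  have hTA : (0 : ℝ) ≤ T_A := Nat.cast_nonneg _
  have hf32 : 32 * (k * ((t : ℝ) + 1) / ε) ≤ f := by
    refine le_trans ?_ hbig
    have : (0 : ℝ) ≤ k * ((t : ℝ) + 1) / ε := by positivity
    nlinarith
  -- if `lam = 0` then `ε_OWF 0 ≥ 1`, which forces `f ≤ 1`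
  rcases Nat.eq_zero_or_pos lam with rfl | hlam0
  · have h3 := hF.one_le_of_zero.trans hxO
    rw [le_div_iff₀ hfR] at h3
    linarith
  -- for `s = 0` the first numerical hypothesis would read `t * 2 ^ t ≤ ε / 2`
  have hs : 1 ≤ s := by
    by_contra hs
    have hs0 : s = 0 := by omega
    have ht1 : (1 : ℝ) ≤ t := by exact_mod_cast hlam0.trans_le hlam
    rw [hs0, Nat.cast_zero, zero_sub, zpow_neg, div_inv_eq_mul, zpow_natCast] at h1
    have h3 : (1 : ℝ) ≤ 2 ^ t := one_le_pow₀ one_le_two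
    nlinarith
  obtain ⟨DF, hDF, hDFe⟩ := hQ₂ lam
  have hm : outLen lam ≤ Q₂.eval lam := by rw [BoolCircuit.size] at hDF; omega
  have hg : DF.gates.length ≤ Q₂.eval lam := by rw [BoolCircuit.size] at hDF; omega
  have hlamK : lam ≤ K.eval lam := by omega
  have hpl := hp lam
  rw [hp₀] at hpl
  have hCMp : ∀ T, (CM k T).size ≤ p.eval lam := fun T =>
    ((hQ₁ k T).trans (natEval_le_natEval Q₁ hk)).trans (by omega)
  -- the surjections go to `ℤ₂^lam × ℤ₂^(t + 1 - lam)`: the preimage of a line under a surjection to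
  -- a space of dimension `t + 1` has dimension `k - t = r + s`
  have hpt := pointTestCost_le (c := t + 1 - lam) hk hlamK (by omega) hm hg
  have hpp : k + (1 + outLen lam + pointTestCost k lam (t + 1 - lam) (outLen lam)
      DF.gates.length) + 1 ≤ p.eval lam := by omega
  obtain ⟨D, hD, hDe⟩ := hQ₃ (κ.eval lam) (p.eval lam) k 1 (by omega)
  have hrec := recoverStepCost_le hk hlamK
  have hhit := hitCost_le hk hlamK
  have hdesc : descLen (iO.outSize (κ.eval lam) (p.eval lam)) 1 ≤ D.size := by
    rw [BoolCircuit.size]; omega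
  have hfI : f ≤ f_iO (κ.eval lam) := hf.trans_le (min_le_right _ _)
  have hfO : f ≤ f_OWF lam := hf.trans_le (min_le_left _ _)
  have hqTf : q.eval lam + T_A ≤ f := by
    have h3 : ((q.eval lam : ℕ) : ℝ) + T_A ≤ f := by
      refine le_trans ?_ hbig
      have : (0 : ℝ) ≤ (q.eval lam : ℕ) + (T_A : ℝ) := by positivity
      nlinarith
    exact_mod_cast h3
  have hdist : descLen (iO.outSize (κ.eval lam) (p.eval lam)) 1 + A.size + 2 * hitCost k lam
      ≤ f_iO (κ.eval lam) := by
    rw [hq] at hqTf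
    omega
  -- the advantage of any algorithm, such as one without gates, is nonnegative
  have hx0 : 0 ≤ ε_iO (κ.eval lam) := (abs_nonneg _).trans
    (hiO.secure _ (p.eval lam) k 1 (CM k ⊥) (CM k ⊥) rfl (hCMp _) (hCMp _) ⟨1, [], fun _ => 0⟩
      (Nat.zero_le _))
  have hx1 : ε_iO (κ.eval lam) ≤ ε / (32 * k * (t + 1)) := by
    refine hxI.trans ?_
    have h3 : ε / (32 * k * (t + 1)) = 1 / (32 * (k * ((t : ℝ) + 1) / ε)) := by field_simp
    rw [h3]
    exact one_div_le_one_div_of_le (by positivity) hf32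
  obtain ⟨N, hN⟩ : ∃ N, N = ⌈6 * ((t : ℝ) + 1) / ε⌉₊ := ⟨_, rfl⟩
  have hfail := failure_le_half (k := k) (t := t) (lam := lam) (by omega) (by omega) hlam hε hε1
    hN le_rfl hx0 hx1
  have hN1 : 1 ≤ N := hN ▸ Nat.one_le_ceil_iff.mpr (by positivity)
  have hN7 : (N : ℝ) ≤ 7 * (((t : ℝ) + 1) / ε) := by
    have h3 : (N : ℝ) < 6 * ((t : ℝ) + 1) / ε + 1 :=
      hN ▸ Nat.ceil_lt_add_one (by positivity)
    rw [mul_div_assoc] at h3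
    linarith
  have hNf : N * (q.eval lam + T_A) ≤ f := by
    have h3 : (N : ℝ) * ((q.eval lam : ℕ) + T_A) ≤ f := by
      refine le_trans (mul_le_mul_of_nonneg_right ?_ (by positivity)) hbig
      linarith
    exact_mod_cast h3
  have hsize : 3 * (N * D.size) + N * A.size +
      2 * (lam * lam + N * recoverStepCost k lam + lam * (lam * 9)) ≤ f := by
    refine le_trans ?_ hNf
    have h3 : lam * lam ≤ K.eval lam ^ 2 := by rw [sq]; gcongr
    have h4 : 3 * D.size + A.size + 2 * recoverStepCost k lam + 20 * (lam * lam)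
        ≤ q.eval lam + T_A := by rw [hq]; omega
    have h5 := Nat.mul_le_mul_left N h4
    exact (inverterSize_le _ _ _ _ hN1).trans h5
  have h0 : 0 ≤ 1 - (ε / 2 - ε_iO (κ.eval lam)) := by linarith
  -- the inverter succeeds with probability at least `1 / 4`, which contradicts `1 / f < 1 / 4`
  have hinv := inversion_bound hiO.secure hCM hCMp hdist DF (hDFe ▸ hF.injective lam) hpp D
    (fun C ρ hC => (hDe C ρ hC).2) (N := N) (d := r + s) (by rw [hr]; omega) (by omega) hE hcon.le
    h0 (θ := ε_OWF lam) (fun B hB => by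
      rw [hDFe]
      exact hF.secure lam B (hB.trans (hsize.trans hfO)))
  have hhalf : (1 / 2 : ℝ) ≤ 1 - 1 / 2 ^ lam := by
    have h3 : (2 : ℝ) ^ 1 ≤ 2 ^ lam := pow_le_pow_right₀ one_le_two hlam0
    have h4 := one_div_le_one_div_of_le (by norm_num) h3
    norm_num at h4 ⊢
    linarith
  have hquarter : (1 / 2 : ℝ) * (1 - 1 / 2) ≤ 1 / f :=
    (mul_le_mul hhalf (sub_le_sub_left hfail 1) (by norm_num) (by linarith)).trans
      (hinv.trans hxO)
  rw [le_div_iff₀ hfR] at hquarter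
  linarith
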